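/- Let $G$ be a connected Lie group modelled on a Hausdorff locally convex real topological vector space (smoothness is understood in the sense of Bastiani–Milnor: all iterated directional derivatives exist and are continuous), let $\mathfrak g = T_1(G)$ be its Lie algebra and $\mathfrak g'$ the topological dual of $\mathfrak g$. For $\lambda\in\mathfrak g'$ let $\mathcal O_\lambda = \{\lambda\circ \mathrm{Ad}(g)^{-1} : g\in G\}$ be its coadjoint orbit. A subset $S\subseteq \mathfrak g'$ is called semi-equicontinuous if its support functional $s_S(x) = \sup_{\alpha\in S}\alpha(-x)\in \mathbb R\cup\{\pm\infty\}$ is bounded above by a real constant on a neighborhood of some point of $\mathfrak g$. Let $\mathfrak g'_{\rm seq}\subseteq\mathfrak g'$ be the union of all semi-equicontinuous coadjoint orbits. Write $[\mathfrak a,\mathfrak b]$ for the linear span of the brackets $[x,y]$, $x\in\mathfrak a$, $y\in\mathfrak b$, and put $D^0(\mathfrak g)=\mathfrak g$, $D^{n+1}(\mathfrak g)=[D^n(\mathfrak g),D^n(\mathfrak g)]$, $C^1(\mathfrak g)=\mathfrak g$, $C^{n+1}(\mathfrak g)=[\mathfrak g,C^n(\mathfrak g)]$. **Theorem.** Suppose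 that $\mathfrak g$ is nilpotent, i.e. $C^n(\mathfrak g)=\{0\}$ for some $n$, or two-step solvable, i.e. $D^2(\mathfrak g)=\{0\}$. Then every semi-equicontinuous coadjoint orbit is trivial: if $\mathcal O_\lambda$ is semi-equicontinuous, then $\mathcal O_\lambda=\{\lambda\}$. Equivalently, $\mathfrak g'_{\rm seq}\subseteq[\mathfrak g,\mathfrak g]^\perp$, i.e. every element of $\mathfrak g'_{\rm seq}$ vanishes on $[\mathfrak g,\mathfrak g]$. -/

import Mathlib

open Set Filter Topology

noncomputable section

namespace LCLie

universe u v

/-! ### Smooth maps between locally convex spaces (in the sense of Bastiani, Michal, Milnor) -/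

section Calculus

variable {E : Type u} [AddCommGroup E] [Module ℝ E] [TopologicalSpace E]
  {F : Type v} [AddCommGroup F] [Module ℝ F] [TopologicalSpace F]

/-- `f` has the directional derivative `L` at `x` in direction `w`:
the quotients `(f (x + t w) - f x) / t` converge to `L` as `t → 0`, `t ≠ 0`. -/
def HasDirDeriv (f : E → F) (x w : E) (L : F) : Prop :=
  Tendsto (fun t : ℝ => t⁻¹ • (f (x + t • w) - f x)) (𝓝[≠] (0 : ℝ)) (𝓝 L)

/-- The directional derivative `df(x)(w)`; it is only meaningful where the limit exists. -/
def dirDeriv (f : E → F) (x w : E) : F :=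
  limUnder (𝓝[≠] (0 : ℝ)) (fun t : ℝ => t⁻¹ • (f (x + t • w) - f x))

end Calculus

/-- `f` is `C^n` on the (open) set `U`: it is continuous on `U`, and, if `n ≥ 1`, all directional
derivatives exist at the points of `U` and `df : U × E → F`, `(x, w) ↦ df(x)(w)`, is `C^(n-1)`. -/
def CDiffOn {F : Type v} [AddCommGroup F] [Module ℝ F] [TopologicalSpace F] :
    ℕ → ∀ {E : Type u} [AddCommGroup E] [Module ℝ E] [TopologicalSpace E],
      (E → F) → Set E → Prop
  | 0, _, _, _, _, f, U => ContinuousOn f U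
  | n + 1, E, _, _, _, f, U =>
      ContinuousOn f U ∧ (∀ x ∈ U, ∀ w : E, ∃ L : F, HasDirDeriv f x w L) ∧
        CDiffOn n (fun p : E × E => dirDeriv f p.1 p.2) (U ×ˢ (univ : Set E))

/-- `f` is smooth on the (open) set `U`. -/
def SmoothOn {E : Type u} [AddCommGroup E] [Module ℝ E] [TopologicalSpace E]
    {F : Type v} [AddCommGroup F] [Module ℝ F] [TopologicalSpace F]
    (f : E → F) (U : Set E) : Prop :=
  ∀ n : ℕ, CDiffOn n f U

/-! ### Locally convex Lie groups -/

/-- `G` is a Lie group modelled on the locally convex space `E`: a topological group with an atlas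
of `E`-valued charts with smooth coordinate changes, such that multiplication and inversion are
smooth in charts. -/
class LocallyConvexLieGroup (E : Type u) [AddCommGroup E] [Module ℝ E] [TopologicalSpace E]
    (G : Type v) [Group G] [TopologicalSpace G] [ChartedSpace E G] : Prop
    extends IsTopologicalGroup G where
  smooth_coordChange : ∀ e ∈ atlas E G, ∀ e' ∈ atlas E G,
    SmoothOn (fun x : E => e' (e.symm x)) {x | x ∈ e.target ∧ e.symm x ∈ e'.source}
  smooth_mul : ∀ e₁ ∈ atlas E G, ∀ e₂ ∈ atlas E G, ∀ e₃ ∈ atlas E G,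
    SmoothOn (fun p : E × E => e₃ (e₁.symm p.1 * e₂.symm p.2))
      {p | p.1 ∈ e₁.target ∧ p.2 ∈ e₂.target ∧ e₁.symm p.1 * e₂.symm p.2 ∈ e₃.source}
  smooth_inv : ∀ e ∈ atlas E G, ∀ e' ∈ atlas E G,
    SmoothOn (fun x : E => e' (e.symm x)⁻¹) {x | x ∈ e.target ∧ (e.symm x)⁻¹ ∈ e'.source}

/-- The underlying topological vector space of the Lie algebra `𝔤 = T₁(G)`: the model space `E`,
to which the tangent space at `1` is identified by the preferred chart at `1`. -/
abbrev LieAlg (E : Type u) (_G : Type v) : Type u := E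

section LieGroup

variable (E : Type u) [AddCommGroup E] [Module ℝ E] [TopologicalSpace E]
  (G : Type v) [Group G] [TopologicalSpace G] [ChartedSpace E G]

/-- The left invariant vector field with value `x ∈ 𝔤` at `1`, written in the preferred chart
`φ` at `1`: at the point `p` of the chart domain it is `T₁(h ↦ φ⁻¹(p) h) x`. -/
def leftInvField (x : LieAlg E G) (p : E) : E :=
  dirDeriv (fun y : E => chartAt E (1 : G)
    ((chartAt E (1 : G)).symm p * (chartAt E (1 : G)).symm y)) (chartAt E (1 : G) 1) x

/-- The Lie bracket on `𝔤`: the value at `1` of the bracket `[X, Y] = dY(X) - dX(Y)` of the left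
invariant vector fields `X`, `Y` with values `x`, `y` at `1`. -/
def lieBracket (x y : LieAlg E G) : LieAlg E G :=
  dirDeriv (leftInvField E G y) (chartAt E (1 : G) 1) x
    - dirDeriv (leftInvField E G x) (chartAt E (1 : G) 1) y

/-- The adjoint action `Ad(g) = T₁(h ↦ g h g⁻¹) : 𝔤 → 𝔤`. -/
def Ad (g : G) (x : LieAlg E G) : LieAlg E G :=
  dirDeriv (fun y : E => chartAt E (1 : G) (g * (chartAt E (1 : G)).symm y * g⁻¹))
    (chartAt E (1 : G) 1) x

/-- The linear span `[A, B]` of all brackets `[x, y]`, `x ∈ A`, `y ∈ B`. -/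
def bracketSpan (A B : Submodule ℝ (LieAlg E G)) : Submodule ℝ (LieAlg E G) :=
  Submodule.span ℝ {z | ∃ x ∈ A, ∃ y ∈ B, lieBracket E G x y = z}

/-- The derived series `D⁰(𝔤) = 𝔤`, `Dⁿ⁺¹(𝔤) = [Dⁿ(𝔤), Dⁿ(𝔤)]`. -/
def derivedSeries : ℕ → Submodule ℝ (LieAlg E G)
  | 0 => ⊤
  | n + 1 => bracketSpan E G (derivedSeries n) (derivedSeries n)

/-- The descending central series, indexed from `0`: the `n`-th term is `Cⁿ⁺¹(𝔤)`, where
`C¹(𝔤) = 𝔤` and `Cⁿ⁺¹(𝔤) = [𝔤, Cⁿ(𝔤)]`. -/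
def centralSeries : ℕ → Submodule ℝ (LieAlg E G)
  | 0 => ⊤
  | n + 1 => bracketSpan E G ⊤ (centralSeries n)

/-- `𝔤` is nilpotent. -/
def IsNilpotentLie : Prop := ∃ n : ℕ, centralSeries E G n = ⊥

/-- `𝔤` is two-step solvable: `D²(𝔤) = {0}`. -/
def IsTwoStepSolvable : Prop := derivedSeries E G 2 = ⊥

/-- The coadjoint orbit of `lam ∈ 𝔤'`: all functionals `Ad*(g) lam = lam ∘ Ad(g)⁻¹`, `g ∈ G`,
where `Ad(g)⁻¹ = Ad(g⁻¹)`. -/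
def coadjointOrbit (lam : LieAlg E G →L[ℝ] ℝ) : Set (LieAlg E G →L[ℝ] ℝ) :=
  {mu | ∃ g : G, ∀ x : LieAlg E G, mu x = lam (Ad E G g⁻¹ x)}

/-- The support functional `s_S(x) = sup ⟨S, -x⟩` of a set `S` of continuous functionals. -/
def supportFunctional (S : Set (E →L[ℝ] ℝ)) (x : E) : EReal :=
  ⨆ α ∈ S, ((α (-x) : ℝ) : EReal)

/-- `S` is semi-equicontinuous: its support functional is bounded (above; it is automatically
locally bounded below for nonempty `S`) on a neighborhood of some point. -/
def SemiEquicontinuous (S : Set (E →L[ℝ] ℝ)) : Prop :=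
  ∃ x₀ : E, ∃ U ∈ 𝓝 x₀, ∃ C : ℝ, ∀ x ∈ U, supportFunctional E S x ≤ (C : EReal)

/-- `𝔤'_seq ⊆ 𝔤'`: the union of all semi-equicontinuous coadjoint orbits. -/
def seqDual : Set (LieAlg E G →L[ℝ] ℝ) :=
  {mu | ∃ lam : LieAlg E G →L[ℝ] ℝ,
    SemiEquicontinuous E (coadjointOrbit E G lam) ∧ mu ∈ coadjointOrbit E G lam}

/-- The annihilator in the topological dual of a linear subspace `A` of `𝔤`. -/
def annihilator (A : Submodule ℝ (LieAlg E G)) : Set (LieAlg E G →L[ℝ] ℝ) :=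
  {α | ∀ x ∈ A, α x = 0}

end LieGroup

end LCLie

end

/-! Write N_k = Ad(k) - 1 and let O be an Ad*-invariant semi-equicontinuous set of functionals. The
bound enters only through `adSubOne_killed_of_sq_killed`. If O kills the image of N_k², then j ↦
μ(Ad(k^j)x) is affine on ℤ with slope μ(N_k x). For x in the open set of the hypothesis it is
bounded on one side, so the slope vanishes. A functional vanishing on a nonempty open set is zero,
hence O kills the image of N_k.

The nilpotent case descends along the central series (`KillsCentral.pred`). An i-fold group
commutator k gives an N_k that raises the filtration by i, and N_k² then raises it by 2i. So at the
last level where O does not yet vanish, N_k² is killed, and therefore N_k is too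
(`KillsCentral.twistKilled`). There need not be an exponential map, so the passage to brackets is by
differentiation at the unit: N_{c(t)}/t tends to ad v, and the derivative of Ad(c(t)) ad(w)
Ad(c(t))⁻¹ is ad [v,w]. Iterated group commutators thus become iterated brackets
(`killsCentral_of_twistKilled`).

In the two-step solvable case a group commutator k acts trivially on the closure of [𝔤,𝔤]
(`adCLM_commutator_of_mem`). Hence N_k² = 0 and O kills N_k. The same differentiation shows that O
kills [𝔤,[𝔤,𝔤]], and one descent step finishes.

Underneath lies a calculus built from Hahn–Banach and the real mean value theorem, with no
completeness assumption. It identifies the bracket with the derivative of Ad (`dirDeriv_localAd`)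
and turns infinitesimal statements into statements about a connected G (`eq_apply_one_of_velocity`).
-/

open Set Filter Topology

set_option linter.unusedSectionVars false

namespace LCLie

universe u v w

/-! ### Elementary rules for directional derivatives. -/

section DirDeriv

variable {E : Type u} [AddCommGroup E] [Module ℝ E] [TopologicalSpace E]
  {F : Type v} [AddCommGroup F] [Module ℝ F] [TopologicalSpace F]
  {H : Type w} [AddCommGroup H] [Module ℝ H] [TopologicalSpace H]

theorem HasDirDeriv.dirDeriv_eq [T2Space F] {f : E → F} {x w : E} {L : F}
    (h : HasDirDeriv f x w L) : dirDeriv f x w = L :=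
  Filter.Tendsto.limUnder_eq h

theorem HasDirDeriv.unique [T2Space F] {f : E → F} {x w : E} {L L' : F}
    (h : HasDirDeriv f x w L) (h' : HasDirDeriv f x w L') : L = L' :=
  tendsto_nhds_unique h h'

theorem hasDirDeriv_const (c : F) (x w : E) : HasDirDeriv (fun _ : E => c) x w 0 := by
  simpa [HasDirDeriv] using tendsto_const_nhds

theorem hasDirDeriv_clm (A : E →L[ℝ] F) (x w : E) : HasDirDeriv A x w (A w) := by
  refine tendsto_const_nhds.congr' ?_
  filter_upwards [self_mem_nhdsWithin] with t (ht : t ≠ 0)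
  simp [smul_smul, ht]

theorem tendsto_line [ContinuousSMul ℝ E] [ContinuousAdd E] (x w : E) :
    Tendsto (fun t : ℝ => x + t • w) (𝓝 0) (𝓝 x) := by
  have : Continuous (fun t : ℝ => x + t • w) := by fun_prop
  simpa using this.tendsto 0

theorem HasDirDeriv.congr_of_eventuallyEq [ContinuousSMul ℝ E] [ContinuousAdd E] {f g : E → F}
    {x w : E} {L : F} (h : HasDirDeriv f x w L) (hfg : f =ᶠ[𝓝 x] g) : HasDirDeriv g x w L := by
  refine h.congr' ?_
  have := ((tendsto_line x w).mono_left (nhdsWithin_le_nhds (s := {0}ᶜ))).eventually hfg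
  filter_upwards [this] with t ht
  rw [ht, hfg.eq_of_nhds]

theorem dirDeriv_congr [ContinuousSMul ℝ E] [ContinuousAdd E] {f g : E → F}
    {x w : E} (hfg : f =ᶠ[𝓝 x] g) : dirDeriv f x w = dirDeriv g x w := by
  unfold dirDeriv limUnder
  congr 1
  refine Filter.map_congr ?_
  have := ((tendsto_line x w).mono_left (nhdsWithin_le_nhds (s := {0}ᶜ))).eventually hfg
  filter_upwards [this] with t ht
  rw [ht, hfg.eq_of_nhds]

theorem HasDirDeriv.smul_dir [ContinuousSMul ℝ F] {f : E → F} {x w : E} {L : F}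
    (h : HasDirDeriv f x w L) (c : ℝ) : HasDirDeriv f x (c • w) (c • L) := by
  rcases eq_or_ne c 0 with rfl | hc
  · simpa [HasDirDeriv] using tendsto_const_nhds
  · have h1 : Tendsto (fun t : ℝ => t * c) (𝓝[≠] 0) (𝓝[≠] 0) := by
      refine tendsto_nhdsWithin_iff.2 ⟨?_, ?_⟩
      · have : Continuous (fun t : ℝ => t * c) := by fun_prop
        simpa using (this.tendsto 0).mono_left nhdsWithin_le_nhds
      · filter_upwards [self_mem_nhdsWithin] with t (ht : t ≠ 0)
        simp [ht, hc]
    have h2 := (h.comp h1).const_smul c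
    refine h2.congr' (Eventually.of_forall fun t => ?_)
    simp [smul_smul, hc]

theorem HasDirDeriv.clm_comp {f : E → F} {x w : E} {L : F} (A : F →L[ℝ] H)
    (h : HasDirDeriv f x w L) : HasDirDeriv (fun y => A (f y)) x w (A L) := by
  refine ((A.continuous.tendsto L).comp h).congr fun t => ?_
  simp

theorem HasDirDeriv.const_smul [ContinuousConstSMul ℝ F] {f : E → F} {x w : E} {L : F} (c : ℝ)
    (hf : HasDirDeriv f x w L) : HasDirDeriv (fun y => c • f y) x w (c • L) := by
  refine (Tendsto.const_smul hf c).congr fun t => ?_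
  rw [← smul_sub, smul_comm]

theorem HasDirDeriv.sub [IsTopologicalAddGroup F] {f g : E → F} {x w : E} {L M : F}
    (hf : HasDirDeriv f x w L) (hg : HasDirDeriv g x w M) :
    HasDirDeriv (fun y => f y - g y) x w (L - M) := by
  refine (Tendsto.sub hf hg).congr fun t => ?_
  rw [← smul_sub]; congr 1; beta_reduce; abel

theorem HasDirDeriv.comp_add_right {f : E → F} {x a w : E} {L : F}
    (hf : HasDirDeriv f (x + a) w L) : HasDirDeriv (fun y => f (y + a)) x w L := by
  refine Tendsto.congr (fun t => ?_) hf
  rw [add_right_comm]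

theorem HasDirDeriv.prodMk {f : E → F} {g : E → H} {x w : E} {L : F} {M : H}
    (hf : HasDirDeriv f x w L) (hg : HasDirDeriv g x w M) :
    HasDirDeriv (fun y => (f y, g y)) x w (L, M) :=
  (Tendsto.prodMk_nhds hf hg).congr fun _ => rfl

theorem hasDirDeriv_real_iff {f : ℝ → ℝ} {x L : ℝ} :
    HasDirDeriv f x 1 L ↔ HasDerivAt f L x := by
  rw [hasDerivAt_iff_tendsto_slope_zero]; simp [HasDirDeriv]

/-- Reparametrization of a directional derivative as the velocity of a curve. -/
theorem HasDirDeriv.comp_line {f : E → F} {x w : E} {L : F} {s : ℝ}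
    (h : HasDirDeriv f (x + s • w) w L) : HasDirDeriv (fun t : ℝ => f (x + t • w)) s 1 L := by
  refine Tendsto.congr (fun t => ?_) h
  simp [add_smul, add_assoc]

/-- A curve with a velocity at `0` is continuous at `0`. -/
theorem HasDirDeriv.continuousAt_line [ContinuousSMul ℝ F] [IsTopologicalAddGroup F] {f : E → F}
    {x w : E} {L : F} (h : HasDirDeriv f x w L) :
    Tendsto (fun t : ℝ => f (x + t • w)) (𝓝 0) (𝓝 (f x)) := by
  have h1 : Tendsto (fun t : ℝ => t • (t⁻¹ • (f (x + t • w) - f x)) + f x) (𝓝[≠] 0)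
      (𝓝 ((0 : ℝ) • L + f x)) :=
    ((tendsto_id.mono_left nhdsWithin_le_nhds).smul h).add_const _
  rw [zero_smul, zero_add] at h1
  have h2 : Tendsto (fun t : ℝ => f (x + t • w)) (𝓝[≠] 0) (𝓝 (f x)) := by
    refine h1.congr' ?_
    filter_upwards [self_mem_nhdsWithin] with t (ht : t ≠ 0)
    simp [smul_smul, ht]
  rw [← nhdsNE_sup_pure, tendsto_sup]
  refine ⟨h2, ?_⟩
  rw [tendsto_pure_left]
  intro s hs
  simpa using mem_of_mem_nhds hs

end DirDeriv

/-! ### The mean value theorem in convex form. -/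

section MeanValue

variable {E : Type u} [AddCommGroup E] [Module ℝ E] [TopologicalSpace E]
  {F : Type v} [AddCommGroup F] [Module ℝ F] [TopologicalSpace F] [IsTopologicalAddGroup F]
  [ContinuousSMul ℝ F] [LocallyConvexSpace ℝ F]

/-- Otherwise a continuous functional separates the increment from C, contradicting the scalar mean
value theorem along the segment. This replaces integrals, which would need completeness of F. -/
theorem sub_mem_of_hasDirDeriv_mem {f : E → F} {x d : E} {D : ℝ → F} {C : Set F}
    (hC : Convex ℝ C) (hCc : IsClosed C)
    (hd : ∀ s ∈ Icc (0 : ℝ) 1, HasDirDeriv f (x + s • d) d (D s))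
    (hD : ∀ s ∈ Icc (0 : ℝ) 1, D s ∈ C) : f (x + d) - f x ∈ C := by
  by_contra hn
  obtain ⟨β, c, hβ, hc⟩ := geometric_hahn_banach_closed_point hC hCc hn
  have key : ∀ s ∈ Icc (0 : ℝ) 1, HasDerivAt (fun s => β (f (x + s • d))) (β (D s)) s :=
    fun s hs => hasDirDeriv_real_iff.1 ((hd s hs).clm_comp β).comp_line
  obtain ⟨s, hs, h⟩ := exists_hasDerivAt_eq_slope (fun s => β (f (x + s • d))) (fun s => β (D s))
    one_pos (fun s hs => (key s hs).continuousAt.continuousWithinAt)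
    (fun s hs => key s (Ioo_subset_Icc_self hs))
  have h1 := hβ _ (hD s (Ioo_subset_Icc_self hs))
  simp at h hc
  linarith

theorem exists_closed_convex_nhd {x : F} {U : Set F} (hU : U ∈ 𝓝 x) :
    ∃ C ∈ 𝓝 x, Convex ℝ C ∧ IsClosed C ∧ C ⊆ U := by
  obtain ⟨V, ⟨hV, hVc⟩, hVU⟩ := (closed_nhds_basis x).mem_iff.1 hU
  obtain ⟨C, ⟨hC, hCc⟩, hCV⟩ := (LocallyConvexSpace.convex_basis (𝕜 := ℝ) x).mem_iff.1 hV
  exact ⟨closure C, mem_of_superset hC subset_closure, hCc.closure, isClosed_closure,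
    (closure_minimal hCV hVc).trans hVU⟩

end MeanValue

/-! ### Strict differentiability, linearity of the derivative and symmetry of second derivatives. -/

section C1

variable {E : Type u} [AddCommGroup E] [Module ℝ E] [TopologicalSpace E]
  {F : Type v} [AddCommGroup F] [Module ℝ F] [TopologicalSpace F]

theorem CDiffOn.continuousOn : ∀ {n : ℕ} {f : E → F} {U : Set E}, CDiffOn n f U → ContinuousOn f U
  | 0, _, _, h => h
  | _ + 1, _, _, h => h.1

theorem CDiffOn.cDiffOn_dirDeriv {n : ℕ} {f : E → F} {U : Set E} (h : CDiffOn (n + 1) f U) :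
    CDiffOn n (fun p : E × E => dirDeriv f p.1 p.2) (U ×ˢ univ) := h.2.2

theorem CDiffOn.hasDirDeriv [T2Space F] {n : ℕ} {f : E → F} {U : Set E}
    (h : CDiffOn (n + 1) f U) {x : E} (hx : x ∈ U) (w : E) :
    HasDirDeriv f x w (dirDeriv f x w) := by
  obtain ⟨L, hL⟩ := h.2.1 x hx w
  rwa [hL.dirDeriv_eq]

theorem CDiffOn.mono {n : ℕ} : ∀ {E : Type u} [AddCommGroup E] [Module ℝ E] [TopologicalSpace E]
    {f : E → F} {U V : Set E}, CDiffOn n f U → V ⊆ U → CDiffOn n f V := by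
  induction n with
  | zero => intro E _ _ _ f U V h hV; exact ContinuousOn.mono h hV
  | succ n ih =>
    intro E _ _ _ f U V h hV
    exact ⟨h.1.mono hV, fun x hx => h.2.1 x (hV hx), ih h.2.2 (prod_mono hV subset_rfl)⟩

theorem CDiffOn.of_succ {n : ℕ} : ∀ {E : Type u} [AddCommGroup E] [Module ℝ E]
    [TopologicalSpace E] {f : E → F} {U : Set E}, CDiffOn (n + 1) f U → CDiffOn n f U := by
  induction n with
  | zero => intro E _ _ _ f U h; exact h.1
  | succ n ih => intro E _ _ _ f U h; exact ⟨h.1, h.2.1, ih h.2.2⟩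

theorem CDiffOn.congr {n : ℕ} : ∀ {E : Type u} [AddCommGroup E] [Module ℝ E]
    [TopologicalSpace E] [IsTopologicalAddGroup E] [ContinuousSMul ℝ E] {f g : E → F} {U : Set E},
    CDiffOn n f U → IsOpen U → EqOn f g U → CDiffOn n g U := by
  induction n with
  | zero => intro E _ _ _ _ _ f g U h _ hfg; exact ContinuousOn.congr h hfg.symm
  | succ n ih =>
    intro E _ _ _ _ _ f g U h hU hfg
    have hev : ∀ x ∈ U, f =ᶠ[𝓝 x] g := fun x hx => hfg.eventuallyEq_of_mem (hU.mem_nhds hx)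
    refine ⟨h.1.congr hfg.symm, fun x hx w => ?_, ?_⟩
    · obtain ⟨L, hL⟩ := h.2.1 x hx w
      exact ⟨L, hL.congr_of_eventuallyEq (hev x hx)⟩
    · exact ih h.2.2 (hU.prod isOpen_univ) fun p hp => dirDeriv_congr (hev p.1 hp.1)

variable [IsTopologicalAddGroup E] [ContinuousSMul ℝ E] [LocallyConvexSpace ℝ E]
  [IsTopologicalAddGroup F] [ContinuousSMul ℝ F] [LocallyConvexSpace ℝ F] [T2Space F]

/-- Strict differentiability of `C¹` maps. -/
theorem CDiffOn.tendsto_strict {f : E → F} {U : Set E} (hf : CDiffOn 1 f U) (hU : IsOpen U)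
    {x w : E} (hx : x ∈ U) {ι : Type*} {l : Filter ι} {a d : ι → E} {τ : ι → ℝ}
    (ha : Tendsto a l (𝓝 x)) (hd : Tendsto d l (𝓝 w)) (hτ : Tendsto τ l (𝓝[≠] 0)) :
    Tendsto (fun i => (τ i)⁻¹ • (f (a i + τ i • d i) - f (a i))) l (𝓝 (dirDeriv f x w)) := by
  rw [tendsto_def]
  intro S hS
  obtain ⟨C, hC, hCc, hCcl, hCS⟩ := exists_closed_convex_nhd hS
  have hcont : ContinuousAt (fun p : E × E => dirDeriv f p.1 p.2) (x, w) :=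
    hf.cDiffOn_dirDeriv.continuousOn.continuousAt ((hU.prod isOpen_univ).mem_nhds ⟨hx, trivial⟩)
  have h1 : ∀ᶠ p : E × E in 𝓝 (x, w), dirDeriv f p.1 p.2 ∈ C := hcont hC
  rw [nhds_prod_eq] at h1
  obtain ⟨A, hA, B, hB, hAB⟩ := Filter.mem_prod_iff.1 h1
  obtain ⟨V, ⟨hV, hVc⟩, hVA⟩ := (LocallyConvexSpace.convex_basis (𝕜 := ℝ) x).mem_iff.1
    (inter_mem hA (hU.mem_nhds hx))
  have hτ0 : Tendsto τ l (𝓝 0) := hτ.mono_right nhdsWithin_le_nhds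
  have hb : Tendsto (fun i => a i + τ i • d i) l (𝓝 x) := by
    simpa using ha.add (hτ0.smul hd)
  filter_upwards [ha hV, hb hV, hd hB, (tendsto_nhdsWithin_iff.1 hτ).2] with i h1 h2 h3 (h4 : τ i ≠ 0)
  refine hCS ?_
  have := sub_mem_of_hasDirDeriv_mem (f := fun y => (τ i)⁻¹ • f y) (x := a i) (d := τ i • d i)
    (D := fun s => dirDeriv f (a i + s • τ i • d i) (d i)) hCc hCcl (fun s hs => ?_)
    (fun s hs => ?_)
  · simpa [smul_sub] using this
  · have hm : a i + s • τ i • d i ∈ V := by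
      simpa using hVc.add_smul_sub_mem h1 h2 hs
    have := ((hf.hasDirDeriv (hVA hm).2 (d i)).smul_dir (τ i)).const_smul (τ i)⁻¹
    rwa [inv_smul_smul₀ h4] at this
  · have hm : a i + s • τ i • d i ∈ V := by
      simpa using hVc.add_smul_sub_mem h1 h2 hs
    have h5 := @hAB (a i + s • τ i • d i, d i) ⟨(hVA hm).1, h3⟩
    exact h5

theorem CDiffOn.comp_hasDirDeriv {f : E → F} {U : Set E} (hf : CDiffOn 1 f U) (hU : IsOpen U)
    {H : Type w} [AddCommGroup H] [Module ℝ H] [TopologicalSpace H] {g : H → E} {x w : H} {L : E}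
    (hx : g x ∈ U) (hg : HasDirDeriv g x w L) :
    HasDirDeriv (fun y => f (g y)) x w (dirDeriv f (g x) L) := by
  have := hf.tendsto_strict hU hx (tendsto_const_nhds (x := g x)) hg tendsto_id
  refine this.congr' ?_
  filter_upwards [self_mem_nhdsWithin] with t (ht : t ≠ 0)
  simp [smul_smul, ht]

theorem CDiffOn.dirDeriv_add {f : E → F} {U : Set E} (hf : CDiffOn 1 f U) (hU : IsOpen U)
    {x : E} (hx : x ∈ U) (v w : E) : dirDeriv f x (v + w) = dirDeriv f x v + dirDeriv f x w := by
  have h1 := hf.tendsto_strict hU hx ((tendsto_line x v).mono_left nhdsWithin_le_nhds)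
    (tendsto_const_nhds (x := w)) (tendsto_id (x := 𝓝[≠] (0 : ℝ)))
  have h2 := Tendsto.add (hf.hasDirDeriv hx v) h1
  refine (hf.hasDirDeriv hx (v + w)).unique (h2.congr fun t => ?_)
  simp only [id, smul_add, add_assoc, smul_sub]
  abel

theorem CDiffOn.dirDeriv_smul {f : E → F} {U : Set E} (hf : CDiffOn 1 f U)
    {x : E} (hx : x ∈ U) (c : ℝ) (w : E) : dirDeriv f x (c • w) = c • dirDeriv f x w :=
  (hf.hasDirDeriv hx (c • w)).unique ((hf.hasDirDeriv hx w).smul_dir c)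

theorem CDiffOn.continuous_dirDeriv {f : E → F} {U : Set E} (hf : CDiffOn 1 f U)
    {x : E} (hx : x ∈ U) : Continuous (fun w => dirDeriv f x w) := by
  have h2 : ContinuousOn (fun w : E => ((x, w) : E × E)) univ := by fun_prop
  have h3 := ContinuousOn.comp (t := U ×ˢ univ) hf.cDiffOn_dirDeriv.continuousOn h2
    fun w _ => mk_mem_prod hx trivial
  exact continuousOn_univ.1 h3

/-- Symmetry of second derivatives, one half. -/
theorem CDiffOn.tendsto_second_difference {f : E → F} {U : Set E} (hf : CDiffOn 1 f U)
    (hU : IsOpen U) {x v w : E} (hx : x ∈ U) (hfv : CDiffOn 1 (fun y => dirDeriv f y v) U) :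
    Tendsto (fun t : ℝ => (t⁻¹ * t⁻¹) • (f (x + t • v + t • w) - f (x + t • v) -
      (f (x + t • w) - f x))) (𝓝[≠] 0) (𝓝 (dirDeriv (fun y => dirDeriv f y v) x w)) := by
  rw [tendsto_def]
  intro S hS
  obtain ⟨C, hC, hCc, hCcl, hCS⟩ := exists_closed_convex_nhd hS
  have hcont : ContinuousAt (fun y => dirDeriv (fun y => dirDeriv f y v) y w) x := by
    have h1 : ContinuousAt (fun p : E × E => dirDeriv (fun y => dirDeriv f y v) p.1 p.2) (x, w) :=
      hfv.cDiffOn_dirDeriv.continuousOn.continuousAt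
        ((hU.prod isOpen_univ).mem_nhds ⟨hx, trivial⟩)
    exact ContinuousAt.comp (f := fun y => (y, w)) h1 (by fun_prop)
  obtain ⟨V, ⟨hV, hVc⟩, hVA⟩ := (LocallyConvexSpace.convex_basis (𝕜 := ℝ) x).mem_iff.1
    (inter_mem (hcont hC) (hU.mem_nhds hx))
  have hvw : Tendsto (fun t : ℝ => x + t • v + t • w) (𝓝 0) (𝓝 x) := by
    simpa [add_assoc] using tendsto_line x (v + w)
  filter_upwards [nhdsWithin_le_nhds (tendsto_line x v hV),
    nhdsWithin_le_nhds (tendsto_line x w hV), nhdsWithin_le_nhds (hvw hV),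
    self_mem_nhdsWithin] with t h1 h2 h3 (h4 : t ≠ 0)
  refine hCS ?_
  have hm1 : ∀ s ∈ Icc (0 : ℝ) 1, x + s • t • v ∈ V := fun s hs => by
    simpa using hVc.add_smul_sub_mem (mem_of_mem_nhds hV) h1 hs
  have hm2 : ∀ s ∈ Icc (0 : ℝ) 1, x + s • t • v + t • w ∈ V := fun s hs => by
    have := hVc.add_smul_sub_mem h2 h3 hs
    convert this using 1
    simp only [add_right_comm x (t • v), add_sub_cancel_left]
    rw [add_right_comm]
  have hm3 : ∀ s ∈ Icc (0 : ℝ) 1, ∀ r ∈ Icc (0 : ℝ) 1, x + s • t • v + r • t • w ∈ V :=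
    fun s hs r hr => by simpa using hVc.add_smul_sub_mem (hm1 s hs) (hm2 s hs) hr
  have inner : ∀ s ∈ Icc (0 : ℝ) 1,
      t⁻¹ • (dirDeriv f (x + s • t • v + t • w) v - dirDeriv f (x + s • t • v) v) ∈ C := by
    intro s hs
    have := sub_mem_of_hasDirDeriv_mem (f := fun y => t⁻¹ • dirDeriv f y v) (x := x + s • t • v)
      (d := t • w)
      (D := fun r => dirDeriv (fun y => dirDeriv f y v) (x + s • t • v + r • t • w) w) hCc hCcl
      (fun r hr => ?_) (fun r hr => (hVA (hm3 s hs r hr)).1)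
    · simpa [smul_sub] using this
    · have := ((hfv.hasDirDeriv (hVA (hm3 s hs r hr)).2 w).smul_dir t).const_smul t⁻¹
      rwa [inv_smul_smul₀ h4] at this
  have := sub_mem_of_hasDirDeriv_mem (f := fun y => (t⁻¹ * t⁻¹) • (f (y + t • w) - f y)) (x := x)
    (d := t • v) (D := fun s => t⁻¹ • (dirDeriv f (x + s • t • v + t • w) v -
      dirDeriv f (x + s • t • v) v)) hCc hCcl (fun s hs => ?_) inner
  · simpa [smul_sub] using this
  · have h5 := (((hf.hasDirDeriv (hVA (hm2 s hs)).2 v).comp_add_right.sub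
      (hf.hasDirDeriv (hVA (hm1 s hs)).2 v)).smul_dir t).const_smul (t⁻¹ * t⁻¹)
    rwa [mul_smul, inv_smul_smul₀ h4] at h5

theorem CDiffOn.dirDeriv_comm {f : E → F} {U : Set E} (hf : CDiffOn 1 f U)
    (hU : IsOpen U) {x v w : E} (hx : x ∈ U) (hfv : CDiffOn 1 (fun y => dirDeriv f y v) U)
    (hfw : CDiffOn 1 (fun y => dirDeriv f y w) U) :
    dirDeriv (fun y => dirDeriv f y v) x w = dirDeriv (fun y => dirDeriv f y w) x v := by
  refine tendsto_nhds_unique (hf.tendsto_second_difference hU hx hfv)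
    ((hf.tendsto_second_difference hU hx hfw).congr fun t => ?_)
  rw [add_right_comm]
  congr 1
  abel

end C1

/-! ### Composition of C^n maps. -/

section Composition

theorem cDiffOn_const {F : Type v} [AddCommGroup F] [Module ℝ F] [TopologicalSpace F] [T2Space F]
    {n : ℕ} : ∀ {E : Type u} [AddCommGroup E] [Module ℝ E] [TopologicalSpace E]
      (c : F) (U : Set E), CDiffOn n (fun _ => c) U := by
  induction n with
  | zero => intro E _ _ _ c U; exact continuousOn_const
  | succ n ih =>
    intro E _ _ _ c U
    refine ⟨continuousOn_const, fun x _ w => ⟨0, hasDirDeriv_const c x w⟩, ?_⟩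
    simpa only [(hasDirDeriv_const c _ _).dirDeriv_eq] using ih 0 (U ×ˢ univ)

theorem cDiffOn_clm {F : Type v} [AddCommGroup F] [Module ℝ F] [TopologicalSpace F] [T2Space F]
    {n : ℕ} : ∀ {E : Type u} [AddCommGroup E] [Module ℝ E] [TopologicalSpace E]
      (A : E →L[ℝ] F) (U : Set E), CDiffOn n A U := by
  induction n with
  | zero => intro E _ _ _ A U; exact A.continuous.continuousOn
  | succ n ih =>
    intro E _ _ _ A U
    refine ⟨A.continuous.continuousOn, fun x _ w => ⟨A w, hasDirDeriv_clm A x w⟩, ?_⟩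
    simp only [(hasDirDeriv_clm A _ _).dirDeriv_eq]
    exact ih (A.comp (ContinuousLinearMap.snd ℝ E E)) (U ×ˢ univ)

theorem CDiffOn.prodMk {F : Type v} [AddCommGroup F] [Module ℝ F] [TopologicalSpace F] [T2Space F]
    {H : Type v} [AddCommGroup H] [Module ℝ H] [TopologicalSpace H] [T2Space H]
    {n : ℕ} : ∀ {E : Type u} [AddCommGroup E] [Module ℝ E] [TopologicalSpace E]
      [IsTopologicalAddGroup E] [ContinuousSMul ℝ E] {f : E → F} {g : E → H} {U : Set E},
      IsOpen U → CDiffOn n f U → CDiffOn n g U → CDiffOn n (fun x => (f x, g x)) U := by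
  induction n with
  | zero => intro E _ _ _ _ _ f g U _ hf hg; exact ContinuousOn.prodMk hf hg
  | succ n ih =>
    intro E _ _ _ _ _ f g U hU hf hg
    have key : ∀ x ∈ U, ∀ w, HasDirDeriv (fun x => (f x, g x)) x w
        (dirDeriv f x w, dirDeriv g x w) := fun x hx w =>
      (hf.hasDirDeriv hx w).prodMk (hg.hasDirDeriv hx w)
    refine ⟨hf.1.prodMk hg.1, fun x hx w => ⟨_, key x hx w⟩, ?_⟩
    exact (ih (hU.prod isOpen_univ) hf.2.2 hg.2.2).congr (hU.prod isOpen_univ) fun p hp =>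
      ((key p.1 hp.1 p.2).dirDeriv_eq).symm

/-- The chain rule d(f∘g)(x,w) = df(g x, dg(x,w)) is again a composition of maps, now on E × E;
hence the spaces are quantified inside the induction on n. -/
theorem CDiffOn.comp {n : ℕ} :
    ∀ {E : Type u} [AddCommGroup E] [Module ℝ E] [TopologicalSpace E]
      [IsTopologicalAddGroup E] [ContinuousSMul ℝ E] [LocallyConvexSpace ℝ E] [T2Space E]
      {H : Type u} [AddCommGroup H] [Module ℝ H] [TopologicalSpace H]
      [IsTopologicalAddGroup H] [ContinuousSMul ℝ H] [LocallyConvexSpace ℝ H] [T2Space H]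
      {F : Type u} [AddCommGroup F] [Module ℝ F] [TopologicalSpace F]
      [IsTopologicalAddGroup F] [ContinuousSMul ℝ F] [LocallyConvexSpace ℝ F] [T2Space F]
      {f : F → H} {g : E → F} {U : Set E} {V : Set F},
      IsOpen U → IsOpen V → CDiffOn n f V → CDiffOn n g U → MapsTo g U V →
      CDiffOn n (fun x => f (g x)) U := by
  induction n with
  | zero =>
    intro E _ _ _ _ _ _ _ H _ _ _ _ _ _ _ F _ _ _ _ _ _ _ f g U V _ _ hf hg h
    exact ContinuousOn.comp hf hg h
  | succ n ih =>
    intro E _ _ _ _ _ _ _ H _ _ _ _ _ _ _ F _ _ _ _ _ _ _ f g U V hU hV hf hg h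
    have hf1 : CDiffOn 1 f V := ⟨hf.1, hf.2.1, hf.2.2.continuousOn⟩
    have key : ∀ x ∈ U, ∀ w, HasDirDeriv (fun x => f (g x)) x w
        (dirDeriv f (g x) (dirDeriv g x w)) := fun x hx w =>
      hf1.comp_hasDirDeriv hV (h hx) (hg.hasDirDeriv hx w)
    refine ⟨ContinuousOn.comp hf.1 hg.1 h, fun x hx w => ⟨_, key x hx w⟩, ?_⟩
    have hU' : IsOpen (U ×ˢ (univ : Set E)) := hU.prod isOpen_univ
    have hg1 : CDiffOn n (fun p : E × E => g p.1) (U ×ˢ univ) :=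
      ih hU' hU hg.of_succ (cDiffOn_clm (ContinuousLinearMap.fst ℝ E E) _) fun p hp => hp.1
    have := ih (f := fun q : F × F => dirDeriv f q.1 q.2)
      (g := fun p : E × E => (g p.1, dirDeriv g p.1 p.2)) (V := V ×ˢ univ) hU'
      (hV.prod isOpen_univ) hf.2.2 (hg1.prodMk hU' hg.2.2) fun p hp => ⟨h hp.1, trivial⟩
    exact this.congr hU' fun p hp => ((key p.1 hp.1 p.2).dirDeriv_eq).symm

end Composition

/-- `f` is `C^n` on an open neighborhood of `x`. -/
def CDiffAt {E : Type u} [AddCommGroup E] [Module ℝ E] [TopologicalSpace E]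
    {F : Type v} [AddCommGroup F] [Module ℝ F] [TopologicalSpace F]
    (n : ℕ) (f : E → F) (x : E) : Prop :=
  ∃ U : Set E, IsOpen U ∧ x ∈ U ∧ CDiffOn n f U

/-! ### Germs of C^n maps at a point. -/

section CDiffAt

variable {E : Type u} [AddCommGroup E] [Module ℝ E] [TopologicalSpace E]
  [IsTopologicalAddGroup E] [ContinuousSMul ℝ E] [LocallyConvexSpace ℝ E] [T2Space E]
  {F : Type u} [AddCommGroup F] [Module ℝ F] [TopologicalSpace F]
  [IsTopologicalAddGroup F] [ContinuousSMul ℝ F] [LocallyConvexSpace ℝ F] [T2Space F]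
  {H : Type u} [AddCommGroup H] [Module ℝ H] [TopologicalSpace H]
  [IsTopologicalAddGroup H] [ContinuousSMul ℝ H] [LocallyConvexSpace ℝ H] [T2Space H]
  {n : ℕ}

theorem cDiffAt_const (c : F) (x : E) : CDiffAt n (fun _ => c) x :=
  ⟨univ, isOpen_univ, trivial, cDiffOn_const c _⟩

theorem cDiffAt_clm (A : E →L[ℝ] F) (x : E) : CDiffAt n A x :=
  ⟨univ, isOpen_univ, trivial, cDiffOn_clm A _⟩

theorem cDiffAt_id (x : F) : CDiffAt n (fun y => y) x :=
  cDiffAt_clm (ContinuousLinearMap.id ℝ F) x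

theorem cDiffAt_fst (x : F × H) : CDiffAt n (fun y : F × H => y.1) x :=
  cDiffAt_clm (ContinuousLinearMap.fst ℝ F H) x

theorem cDiffAt_snd (x : F × H) : CDiffAt n (fun y : F × H => y.2) x :=
  cDiffAt_clm (ContinuousLinearMap.snd ℝ F H) x

theorem CDiffAt.congr {f g : E → F} {x : E} (hf : CDiffAt n f x) (h : f =ᶠ[𝓝 x] g) :
    CDiffAt n g x := by
  obtain ⟨U, hU, hx, hf⟩ := hf
  obtain ⟨V, hVs, hV, hxV⟩ := eventually_nhds_iff.1 h
  exact ⟨U ∩ V, hU.inter hV, ⟨hx, hxV⟩,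
    (hf.mono inter_subset_left).congr (hU.inter hV) fun y hy => hVs y hy.2⟩

theorem CDiffAt.prodMk {f : E → F} {g : E → H} {x : E} (hf : CDiffAt n f x)
    (hg : CDiffAt n g x) : CDiffAt n (fun y => (f y, g y)) x := by
  obtain ⟨U, hU, hx, hf⟩ := hf
  obtain ⟨V, hV, hxV, hg⟩ := hg
  exact ⟨U ∩ V, hU.inter hV, ⟨hx, hxV⟩, CDiffOn.prodMk (hU.inter hV)
    (hf.mono inter_subset_left) (hg.mono inter_subset_right)⟩

theorem CDiffAt.continuousAt {f : E → F} {x : E} (hf : CDiffAt n f x) : ContinuousAt f x := by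
  obtain ⟨U, hU, hx, hf⟩ := hf
  exact hf.continuousOn.continuousAt (hU.mem_nhds hx)

theorem CDiffAt.comp {f : F → H} {g : E → F} {x : E} (hf : CDiffAt n f (g x))
    (hg : CDiffAt n g x) : CDiffAt n (fun y => f (g y)) x := by
  obtain ⟨V, hV, hxV, hf⟩ := hf
  obtain ⟨U, hU, hx, hg⟩ := hg
  have hW : IsOpen (U ∩ g ⁻¹' V) := hg.continuousOn.isOpen_inter_preimage hU hV
  exact ⟨_, hW, ⟨hx, hxV⟩, CDiffOn.comp hW hV hf (hg.mono inter_subset_left) fun y hy => hy.2⟩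

theorem CDiffAt.dirDeriv {f : E → F} {x : E} (hf : CDiffAt (n + 1) f x) (w : E) :
    CDiffAt n (fun p : E × E => dirDeriv f p.1 p.2) (x, w) := by
  obtain ⟨U, hU, hx, hf⟩ := hf
  exact ⟨_, hU.prod isOpen_univ, ⟨hx, trivial⟩, hf.cDiffOn_dirDeriv⟩

theorem CDiffAt.hasDirDeriv {f : E → F} {x : E} (hf : CDiffAt 1 f x) (w : E) :
    HasDirDeriv f x w (LCLie.dirDeriv f x w) := by
  obtain ⟨U, hU, hx, hf⟩ := hf
  exact hf.hasDirDeriv hx w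

theorem CDiffAt.comp_hasDirDeriv {f : F → H} {D : Type w} [AddCommGroup D] [Module ℝ D]
    [TopologicalSpace D] {g : D → F} {x w : D} {L : F} (hf : CDiffAt 1 f (g x))
    (hg : HasDirDeriv g x w L) :
    HasDirDeriv (fun y => f (g y)) x w (LCLie.dirDeriv f (g x) L) := by
  obtain ⟨U, hU, hx, hf⟩ := hf
  exact hf.comp_hasDirDeriv hU hx hg

theorem CDiffAt.comp_hasDirDeriv_of_eq {f : F → H} {D : Type w} [AddCommGroup D] [Module ℝ D]
    [TopologicalSpace D] {g : D → F} {x w : D} {y L : F} (hf : CDiffAt 1 f y) (hy : g x = y)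
    (hg : HasDirDeriv g x w L) :
    HasDirDeriv (fun y => f (g y)) x w (LCLie.dirDeriv f y L) := by
  subst hy; exact hf.comp_hasDirDeriv hg

theorem CDiffAt.dirDeriv_add {f : F → H} {x : F} (hf : CDiffAt 1 f x) (v w : F) :
    LCLie.dirDeriv f x (v + w) = LCLie.dirDeriv f x v + LCLie.dirDeriv f x w := by
  obtain ⟨U, hU, hx, hf⟩ := hf
  exact hf.dirDeriv_add hU hx v w

theorem CDiffAt.dirDeriv_smul {f : F → H} {x : F} (hf : CDiffAt 1 f x) (c : ℝ) (w : F) :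
    LCLie.dirDeriv f x (c • w) = c • LCLie.dirDeriv f x w := by
  obtain ⟨U, hU, hx, hf⟩ := hf
  exact hf.dirDeriv_smul hx c w

/-- The derivative of a `C¹` map as a continuous linear map. -/
noncomputable def CDiffAt.clm {f : F → H} {x : F} (hf : CDiffAt 1 f x) : F →L[ℝ] H where
  toFun := LCLie.dirDeriv f x
  map_add' := hf.dirDeriv_add
  map_smul' := hf.dirDeriv_smul
  cont := by
    obtain ⟨U, hU, hx, hf⟩ := hf
    exact hf.continuous_dirDeriv hx

theorem CDiffAt.dirDeriv_comm {f : F → H} {x : F} (hf : CDiffAt 2 f x) (v w : F) :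
    LCLie.dirDeriv (fun y => LCLie.dirDeriv f y v) x w =
      LCLie.dirDeriv (fun y => LCLie.dirDeriv f y w) x v := by
  obtain ⟨U, hU, hx, hf⟩ := hf
  have key : ∀ v, CDiffOn 1 (fun y => LCLie.dirDeriv f y v) U := fun v =>
    CDiffOn.comp (f := fun p : F × F => LCLie.dirDeriv f p.1 p.2) (g := fun y => (y, v)) hU
      (hU.prod isOpen_univ) hf.cDiffOn_dirDeriv
      (CDiffOn.prodMk hU (cDiffOn_clm (ContinuousLinearMap.id ℝ F) U) (cDiffOn_const v U))
      fun y hy => ⟨hy, trivial⟩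
  exact hf.of_succ.dirDeriv_comm hU hx (key v) (key w)

end CDiffAt

/-! ### Smooth maps into a Lie group and the adjoint representation -/

section SmoothIntoGroup

variable {E : Type u} [AddCommGroup E] [Module ℝ E] [TopologicalSpace E]
  [IsTopologicalAddGroup E] [ContinuousSMul ℝ E] [LocallyConvexSpace ℝ E] [T2Space E]
  {G : Type v} [Group G] [TopologicalSpace G] [ChartedSpace E G] [LocallyConvexLieGroup E G]
  {D : Type u} [AddCommGroup D] [Module ℝ D] [TopologicalSpace D]
  [IsTopologicalAddGroup D] [ContinuousSMul ℝ D] [LocallyConvexSpace ℝ D] [T2Space D]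

theorem cDiffAt_coordChange {e e' : OpenPartialHomeomorph G E} (he : e ∈ atlas E G)
    (he' : e' ∈ atlas E G) {x : E} (hx : x ∈ e.target) (hx' : e.symm x ∈ e'.source) (n : ℕ) :
    CDiffAt n (fun y => e' (e.symm y)) x :=
  ⟨_, e.isOpen_inter_preimage_symm e'.open_source, ⟨hx, hx'⟩,
    LocallyConvexLieGroup.smooth_coordChange e he e' he' n⟩

theorem cDiffAt_inv {e e' : OpenPartialHomeomorph G E} (he : e ∈ atlas E G)
    (he' : e' ∈ atlas E G) {x : E} (hx : x ∈ e.target) (hx' : (e.symm x)⁻¹ ∈ e'.source) (n : ℕ) :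
    CDiffAt n (fun y => e' (e.symm y)⁻¹) x := by
  have : IsTopologicalGroup G := LocallyConvexLieGroup.toIsTopologicalGroup E
  refine ⟨{x | x ∈ e.target ∧ (e.symm x)⁻¹ ∈ e'.source}, ?_, ⟨hx, hx'⟩,
    LocallyConvexLieGroup.smooth_inv e he e' he' n⟩
  exact e.continuousOn_symm.inv.isOpen_inter_preimage e.open_target e'.open_source

theorem cDiffAt_mul {e₁ e₂ e₃ : OpenPartialHomeomorph G E} (h₁ : e₁ ∈ atlas E G)
    (h₂ : e₂ ∈ atlas E G) (h₃ : e₃ ∈ atlas E G) {p : E × E} (hp₁ : p.1 ∈ e₁.target)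
    (hp₂ : p.2 ∈ e₂.target) (hp : e₁.symm p.1 * e₂.symm p.2 ∈ e₃.source) (n : ℕ) :
    CDiffAt n (fun p : E × E => e₃ (e₁.symm p.1 * e₂.symm p.2)) p := by
  have : IsTopologicalGroup G := LocallyConvexLieGroup.toIsTopologicalGroup E
  refine ⟨{p | p.1 ∈ e₁.target ∧ p.2 ∈ e₂.target ∧ e₁.symm p.1 * e₂.symm p.2 ∈ e₃.source}, ?_,
    ⟨hp₁, hp₂, hp⟩, LocallyConvexLieGroup.smooth_mul e₁ h₁ e₂ h₂ e₃ h₃ n⟩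
  have hc : ContinuousOn (fun p : E × E => e₁.symm p.1 * e₂.symm p.2) (e₁.target ×ˢ e₂.target) :=
    (e₁.continuousOn_symm.comp continuousOn_fst fun p hp => hp.1).mul
      (e₂.continuousOn_symm.comp continuousOn_snd fun p hp => hp.2)
  have := hc.isOpen_inter_preimage (e₁.open_target.prod e₂.open_target) e₃.open_source
  convert this using 1
  ext p
  simp [and_assoc]

variable (E) in
/-- A map into `G` is smooth near `x`. -/
def GSmoothAt (f : D → G) (x : D) : Prop :=
  ContinuousAt f x ∧ ∃ e ∈ atlas E G, f x ∈ e.source ∧ ∀ n, CDiffAt n (fun y => e (f y)) x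

/-- Coordinate changes are smooth, so testing in one chart suffices for all. -/
theorem GSmoothAt.cDiffAt {f : D → G} {x : D} (hf : GSmoothAt E f x)
    {e : OpenPartialHomeomorph G E} (he : e ∈ atlas E G) (hx : f x ∈ e.source) (n : ℕ) :
    CDiffAt n (fun y => e (f y)) x := by
  obtain ⟨hc, e', he', hx', h⟩ := hf
  have h1 : CDiffAt n (fun z => e (e'.symm z)) (e' (f x)) :=
    cDiffAt_coordChange he' he (e'.map_source hx') (by rwa [e'.left_inv hx']) n
  refine (CDiffAt.comp h1 (h n)).congr ?_
  filter_upwards [hc (e'.open_source.mem_nhds hx')] with y hy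
  rw [e'.left_inv hy]

theorem gSmoothAt_symm {e : OpenPartialHomeomorph G E} (he : e ∈ atlas E G) {x : E}
    (hx : x ∈ e.target) : GSmoothAt E e.symm x := by
  refine ⟨e.continuousAt_symm hx, e, he, e.map_target hx, fun n => (cDiffAt_id x).congr ?_⟩
  filter_upwards [e.open_target.mem_nhds hx] with y hy
  rw [e.right_inv hy]

theorem gSmoothAt_const (g : G) (x : D) : GSmoothAt E (fun _ : D => g) x :=
  ⟨continuousAt_const, chartAt E g, chart_mem_atlas E g, mem_chart_source E g,
    fun _ => cDiffAt_const _ x⟩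

theorem GSmoothAt.comp {D' : Type u} [AddCommGroup D'] [Module ℝ D'] [TopologicalSpace D']
    [IsTopologicalAddGroup D'] [ContinuousSMul ℝ D'] [LocallyConvexSpace ℝ D'] [T2Space D']
    {f : D → G} {k : D' → D} {x : D'} (hf : GSmoothAt E f (k x)) (hk : ∀ n, CDiffAt n k x) :
    GSmoothAt E (fun y => f (k y)) x := by
  obtain ⟨hc, e, he, hx, h⟩ := hf
  exact ⟨ContinuousAt.comp hc (hk 0).continuousAt, e, he, hx, fun n => CDiffAt.comp (h n) (hk n)⟩

theorem GSmoothAt.mul {f g : D → G} {x : D} (hf : GSmoothAt E f x) (hg : GSmoothAt E g x) :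
    GSmoothAt E (fun y => f y * g y) x := by
  have : IsTopologicalGroup G := LocallyConvexLieGroup.toIsTopologicalGroup E
  obtain ⟨hc, e, he, hx, h⟩ := hf
  obtain ⟨hc', e', he', hx', h'⟩ := hg
  refine ⟨hc.mul hc', chartAt E (f x * g x), chart_mem_atlas E _, mem_chart_source E _,
    fun n => ?_⟩
  have h1 := cDiffAt_mul he he' (chart_mem_atlas E (f x * g x)) (p := (e (f x), e' (g x)))
    (e.map_source hx) (e'.map_source hx')
    (by simp only [e.left_inv hx, e'.left_inv hx']; exact mem_chart_source E _) n
  refine (CDiffAt.comp (g := fun y => (e (f y), e' (g y))) h1 ((h n).prodMk (h' n))).congr ?_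
  filter_upwards [hc (e.open_source.mem_nhds hx), hc' (e'.open_source.mem_nhds hx')] with y hy hy'
  simp only [e.left_inv hy, e'.left_inv hy']

theorem GSmoothAt.inv {f : D → G} {x : D} (hf : GSmoothAt E f x) :
    GSmoothAt E (fun y => (f y)⁻¹) x := by
  have : IsTopologicalGroup G := LocallyConvexLieGroup.toIsTopologicalGroup E
  obtain ⟨hc, e, he, hx, h⟩ := hf
  refine ⟨hc.inv, chartAt E (f x)⁻¹, chart_mem_atlas E _, mem_chart_source E _, fun n => ?_⟩
  have h1 := cDiffAt_inv he (chart_mem_atlas E (f x)⁻¹) (x := e (f x)) (e.map_source hx)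
    (by rw [e.left_inv hx]; exact mem_chart_source E _) n
  refine (CDiffAt.comp h1 (h n)).congr ?_
  filter_upwards [hc (e.open_source.mem_nhds hx)] with y hy
  simp only [e.left_inv hy]

end SmoothIntoGroup

/-! ### The adjoint action and velocities of curves at the unit. -/

section Adjoint

variable (E : Type u) [AddCommGroup E] [Module ℝ E] [TopologicalSpace E]
  [IsTopologicalAddGroup E] [ContinuousSMul ℝ E] [LocallyConvexSpace ℝ E] [T2Space E]
  (G : Type v) [Group G] [TopologicalSpace G] [ChartedSpace E G] [LocallyConvexLieGroup E G]

/-- The preferred chart at the unit. -/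
abbrev unitChart : OpenPartialHomeomorph G E := chartAt E (1 : G)

/-- The coordinates of the unit. -/
abbrev unitPt : E := unitChart E G 1

theorem unitPt_mem : unitPt E G ∈ (unitChart E G).target := mem_chart_target E 1

@[simp] theorem unitChart_symm_unitPt : (unitChart E G).symm (unitPt E G) = 1 :=
  (unitChart E G).left_inv (mem_chart_source E 1)

theorem gSmoothAt_unitChart_symm : GSmoothAt E (unitChart E G).symm (unitPt E G) :=
  gSmoothAt_symm (chart_mem_atlas E 1) (unitPt_mem E G)

variable {G} in
theorem cDiffAt_conj (g : G) (n : ℕ) : CDiffAt n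
    (fun y : E => unitChart E G (g * (unitChart E G).symm y * g⁻¹)) (unitPt E G) :=
  (((gSmoothAt_const g _).mul (gSmoothAt_unitChart_symm E G)).mul (gSmoothAt_const g⁻¹ _)).cDiffAt
    (chart_mem_atlas E 1) (by simp) n

variable {G} in
/-- The adjoint action of a group element as a continuous linear map. -/
noncomputable def adCLM (g : G) : E →L[ℝ] E := (cDiffAt_conj E g 1).clm

variable {G} in
theorem adCLM_apply (g : G) (x : E) : adCLM E g x = Ad E G g x := rfl

variable {G} in
theorem hasDirDeriv_conj (g : G) (x : E) : HasDirDeriv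
    (fun y : E => unitChart E G (g * (unitChart E G).symm y * g⁻¹)) (unitPt E G) x
      (adCLM E g x) :=
  (cDiffAt_conj E g 1).hasDirDeriv x

/-- A curve in `G` starting at the unit with the velocity `w`, in the preferred chart. -/
def HasVelocity (c : ℝ → G) (w : E) : Prop :=
  c 0 = 1 ∧ (∀ᶠ t in 𝓝 0, c t ∈ (unitChart E G).source) ∧
    HasDirDeriv (fun t => unitChart E G (c t)) 0 1 w

variable {E G}

theorem GSmoothAt.exists_hasVelocity {f : E → G} {x : E} (hf : GSmoothAt E f x) (hx : f x = 1)
    {c : ℝ → E} {w : E} (h0 : c 0 = x) (hc : ContinuousAt c 0) (hd : HasDirDeriv c 0 1 w) :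
    HasVelocity E G (fun t => f (c t)) (dirDeriv (fun y => unitChart E G (f y)) x w) := by
  have hs : f x ∈ (unitChart E G).source := by rw [hx]; exact mem_chart_source E 1
  refine ⟨by simp [h0, hx], ?_, ?_⟩
  · have h1 : ContinuousAt (fun t => f (c t)) 0 :=
      ContinuousAt.comp (f := c) (by rw [h0]; exact hf.1) hc
    exact h1 ((unitChart E G).open_source.mem_nhds (by simpa [h0] using hs))
  · exact (hf.cDiffAt (chart_mem_atlas E 1) hs 1).comp_hasDirDeriv_of_eq h0 hd

theorem hasDirDeriv_line (x w : E) : HasDirDeriv (fun t : ℝ => x + t • w) 0 1 w := by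
  refine tendsto_const_nhds.congr' ?_
  filter_upwards [self_mem_nhdsWithin] with t (ht : t ≠ 0)
  simp [inv_smul_smul₀ ht]

theorem exists_hasVelocity (w : E) : ∃ c : ℝ → G, HasVelocity E G c w := by
  have h := (gSmoothAt_unitChart_symm E G).exists_hasVelocity (unitChart_symm_unitPt E G)
    (c := fun t => unitPt E G + t • w) (by simp) (by fun_prop) (hasDirDeriv_line _ w)
  refine ⟨fun t => (unitChart E G).symm (unitPt E G + t • w), ?_⟩
  convert h
  refine (HasDirDeriv.dirDeriv_eq (HasDirDeriv.congr_of_eventuallyEq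
    (hasDirDeriv_clm (ContinuousLinearMap.id ℝ E) _ w) ?_)).symm
  filter_upwards [(unitChart E G).open_target.mem_nhds (unitPt_mem E G)] with y hy
  rw [(unitChart E G).right_inv hy]; rfl

theorem HasVelocity.tendsto_coord {c : ℝ → G} {w : E} (hc : HasVelocity E G c w) :
    ContinuousAt (fun t => unitChart E G (c t)) 0 := by
  simpa [ContinuousAt] using hc.2.2.continuousAt_line

theorem HasVelocity.comp {c : ℝ → G} {w : E} (hc : HasVelocity E G c w) {f : G → G}
    (hf : GSmoothAt E (fun y => f ((unitChart E G).symm y)) (unitPt E G)) (h1 : f 1 = 1) :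
    HasVelocity E G (fun t => f (c t))
      (dirDeriv (fun y => unitChart E G (f ((unitChart E G).symm y))) (unitPt E G) w) := by
  have h := hf.exists_hasVelocity (by simp [h1]) (c := fun t => unitChart E G (c t))
    (by simp [hc.1]) hc.tendsto_coord hc.2.2
  have hev : ∀ᶠ t in 𝓝 (0 : ℝ), f ((unitChart E G).symm (unitChart E G (c t))) = f (c t) := by
    filter_upwards [hc.2.1] with t ht
    rw [(unitChart E G).left_inv ht]
  refine ⟨by simp [hc.1, h1], ?_, h.2.2.congr_of_eventuallyEq ?_⟩
  · filter_upwards [h.2.1, hev] with t ht ht'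
    rwa [ht'] at ht
  · filter_upwards [hev] with t ht
    rw [ht]

theorem HasVelocity.conj {c : ℝ → G} {w : E} (hc : HasVelocity E G c w) (g : G) :
    HasVelocity E G (fun t => g * c t * g⁻¹) (adCLM E g w) :=
  hc.comp (f := fun h => g * h * g⁻¹)
    (((gSmoothAt_const g _).mul (gSmoothAt_unitChart_symm E G)).mul (gSmoothAt_const g⁻¹ _))
    (by simp)

theorem HasVelocity.inv {c : ℝ → G} {w : E} (hc : HasVelocity E G c w) :
    ∃ w', HasVelocity E G (fun t => (c t)⁻¹) w' :=
  ⟨_, hc.comp (f := fun h => h⁻¹) (gSmoothAt_unitChart_symm E G).inv (by simp)⟩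

theorem adCLM_one : adCLM E (1 : G) = ContinuousLinearMap.id ℝ E := by
  ext x
  refine (hasDirDeriv_conj E (1 : G) x).unique (HasDirDeriv.congr_of_eventuallyEq
    (hasDirDeriv_clm (ContinuousLinearMap.id ℝ E) _ x) ?_)
  filter_upwards [(unitChart E G).open_target.mem_nhds (unitPt_mem E G)] with y hy
  simp [(unitChart E G).right_inv hy]

theorem adCLM_mul (g h : G) : adCLM E (g * h) = (adCLM E g).comp (adCLM E h) := by
  have : IsTopologicalGroup G := LocallyConvexLieGroup.toIsTopologicalGroup E
  ext x
  refine (hasDirDeriv_conj E (g * h) x).unique (HasDirDeriv.congr_of_eventuallyEq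
    ((cDiffAt_conj E g 1).comp_hasDirDeriv_of_eq (by simp) (hasDirDeriv_conj E h x)) ?_)
  have hc : ContinuousAt (fun y => h * (unitChart E G).symm y * h⁻¹) (unitPt E G) :=
    (continuousAt_const.mul ((unitChart E G).continuousAt_symm (unitPt_mem E G))).mul
      continuousAt_const
  filter_upwards [hc ((unitChart E G).open_source.mem_nhds (by simp))] with y hy
  rw [(unitChart E G).left_inv hy]
  simp [mul_assoc]

theorem adCLM_mul_apply (g h : G) (x : E) : adCLM E (g * h) x = adCLM E g (adCLM E h x) := by
  rw [adCLM_mul]; rfl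

@[simp] theorem adCLM_one_apply (x : E) : adCLM E (1 : G) x = x := by
  rw [adCLM_one]; rfl

@[simp] theorem adCLM_inv_apply_self (g : G) (x : E) : adCLM E g⁻¹ (adCLM E g x) = x := by
  rw [← adCLM_mul_apply]; simp

@[simp] theorem adCLM_apply_inv_self (g : G) (x : E) : adCLM E g (adCLM E g⁻¹ x) = x := by
  rw [← adCLM_mul_apply]; simp

end Adjoint

/-! ### The bracket as the derivative of the adjoint representation -/

section Bracket

variable (E : Type u) [AddCommGroup E] [Module ℝ E] [TopologicalSpace E]
  [IsTopologicalAddGroup E] [ContinuousSMul ℝ E] [LocallyConvexSpace ℝ E] [T2Space E]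
  (G : Type v) [Group G] [TopologicalSpace G] [ChartedSpace E G] [LocallyConvexLieGroup E G]

/-- The multiplication near the unit in the preferred chart. -/
def localMul (p : E × E) : E :=
  unitChart E G ((unitChart E G).symm p.1 * (unitChart E G).symm p.2)

/-- The conjugation near the unit in the preferred chart. -/
def localConj (p : E × E) : E :=
  unitChart E G ((unitChart E G).symm p.1 * (unitChart E G).symm p.2 *
    ((unitChart E G).symm p.1)⁻¹)

theorem gSmoothAt_symm_fst (p : E × E) (hp : p.1 ∈ (unitChart E G).target) :
    GSmoothAt E (fun p : E × E => (unitChart E G).symm p.1) p :=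
  (gSmoothAt_symm (chart_mem_atlas E 1) hp).comp fun _ => cDiffAt_fst _

theorem gSmoothAt_symm_snd (p : E × E) (hp : p.2 ∈ (unitChart E G).target) :
    GSmoothAt E (fun p : E × E => (unitChart E G).symm p.2) p :=
  (gSmoothAt_symm (chart_mem_atlas E 1) hp).comp fun _ => cDiffAt_snd _

theorem cDiffAt_localMul (n : ℕ) : CDiffAt n (localMul E G) (unitPt E G, unitPt E G) :=
  ((gSmoothAt_symm_fst E G _ (unitPt_mem E G)).mul
    (gSmoothAt_symm_snd E G _ (unitPt_mem E G))).cDiffAt (chart_mem_atlas E 1) (by simp) n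

theorem cDiffAt_localConj (n : ℕ) : CDiffAt n (localConj E G) (unitPt E G, unitPt E G) :=
  (((gSmoothAt_symm_fst E G _ (unitPt_mem E G)).mul
    (gSmoothAt_symm_snd E G _ (unitPt_mem E G))).mul
    (gSmoothAt_symm_fst E G _ (unitPt_mem E G)).inv).cDiffAt (chart_mem_atlas E 1) (by simp) n

theorem dirDeriv_localConj (p x : E) :
    dirDeriv (localConj E G) (p, unitPt E G) (0, x) = adCLM E ((unitChart E G).symm p) x := by
  rw [adCLM_apply]
  simp [dirDeriv, Ad, localConj]

/-- The adjoint action near the unit, in the preferred chart. -/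
noncomputable def localAd (q : E × E) : E := adCLM E ((unitChart E G).symm q.1) q.2

@[simp] theorem localAd_unitPt (x : E) : localAd E G (unitPt E G, x) = x := by
  simp [localAd]

theorem cDiffAt_localAd (x : E) (n : ℕ) : CDiffAt n (localAd E G) (unitPt E G, x) := by
  have h := (cDiffAt_localConj E G (n + 1)).dirDeriv (0, x)
  have h2 : CDiffAt n (fun q : E × E => ((q.1, unitPt E G), ((0 : E), q.2))) (unitPt E G, x) :=
    ((cDiffAt_fst _).prodMk (cDiffAt_const _ _)).prodMk ((cDiffAt_const _ _).prodMk (cDiffAt_snd _))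
  have h3 := CDiffAt.comp (g := fun q : E × E => ((q.1, unitPt E G), ((0 : E), q.2))) h h2
  simp only [dirDeriv_localConj] at h3
  exact h3

theorem dirDeriv_localMul_snd (p x : E) :
    dirDeriv (localMul E G) (p, unitPt E G) (0, x) = leftInvField E G x p := by
  simp [dirDeriv, leftInvField, localMul]

variable {E G} in
theorem eventually_cDiffAt {F : Type u} [AddCommGroup F] [Module ℝ F] [TopologicalSpace F]
    {n : ℕ} {f : E → F} {x : E} (h : CDiffAt n f x) : ∀ᶠ y in 𝓝 x, CDiffAt n f y := by
  obtain ⟨U, hU, hx, hf⟩ := h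
  filter_upwards [hU.mem_nhds hx] with y hy
  exact ⟨U, hU, hy, hf⟩

/-- From p·y = (p y p⁻¹)·p: a left translate is a right translate of the conjugate. This brings Ad
into the left invariant fields. -/
theorem leftInvField_eventually_eq (x : E) : ∀ᶠ p in 𝓝 (unitPt E G),
    leftInvField E G x p = dirDeriv (localMul E G) (unitPt E G, p) (localAd E G (p, x), 0) := by
  have : IsTopologicalGroup G := LocallyConvexLieGroup.toIsTopologicalGroup E
  have e1 : Tendsto (fun p : E => (p, unitPt E G)) (𝓝 (unitPt E G))
      (𝓝 (unitPt E G, unitPt E G)) :=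
    (Continuous.tendsto' (by fun_prop) _ _ rfl)
  have e2 : Tendsto (fun p : E => (unitPt E G, p)) (𝓝 (unitPt E G))
      (𝓝 (unitPt E G, unitPt E G)) :=
    (Continuous.tendsto' (by fun_prop) _ _ rfl)
  filter_upwards [(unitChart E G).open_target.mem_nhds (unitPt_mem E G),
    e1 (eventually_cDiffAt (cDiffAt_localMul E G 1)),
    e2 (eventually_cDiffAt (cDiffAt_localMul E G 1)),
    e1 (eventually_cDiffAt (cDiffAt_localConj E G 1))] with p hp h1 h2 h3
  have hK : HasDirDeriv (fun y => localConj E G (p, y)) (unitPt E G) x (localAd E G (p, x)) := by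
    have := CDiffAt.comp_hasDirDeriv_of_eq (g := fun y : E => (p, y)) (x := unitPt E G) h3 rfl
      ((hasDirDeriv_const p _ x).prodMk (hasDirDeriv_clm (ContinuousLinearMap.id ℝ E) _ x))
    simpa [dirDeriv_localConj, localAd] using this
  have hR := CDiffAt.comp_hasDirDeriv_of_eq
    (g := fun y : E => (localConj E G (p, y), p)) (x := unitPt E G) h2 (by simp [localConj])
      (hK.prodMk (hasDirDeriv_const p _ x))
  have hL := CDiffAt.comp_hasDirDeriv_of_eq (g := fun y : E => (p, y)) (x := unitPt E G) h1 rfl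
      ((hasDirDeriv_const p _ x).prodMk (hasDirDeriv_clm (ContinuousLinearMap.id ℝ E) _ x))
  rw [← dirDeriv_localMul_snd]
  refine hL.unique (hR.congr_of_eventuallyEq ?_)
  have hc : ContinuousAt (fun y => (unitChart E G).symm p * (unitChart E G).symm y *
      ((unitChart E G).symm p)⁻¹) (unitPt E G) :=
    (continuousAt_const.mul ((unitChart E G).continuousAt_symm (unitPt_mem E G))).mul
      continuousAt_const
  filter_upwards [hc ((unitChart E G).open_source.mem_nhds (by simp))] with y hy
  simp only [localMul, localConj]
  rw [(unitChart E G).left_inv hy]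
  simp

theorem localMul_fst_eventually :
    (fun p : E => localMul E G (p, unitPt E G)) =ᶠ[𝓝 (unitPt E G)] id := by
  filter_upwards [(unitChart E G).open_target.mem_nhds (unitPt_mem E G)] with y hy
  simp [localMul, (unitChart E G).right_inv hy]

theorem dirDeriv_localMul_fst (x : E) :
    dirDeriv (localMul E G) (unitPt E G, unitPt E G) (x, 0) = x := by
  have h := CDiffAt.comp_hasDirDeriv_of_eq (g := fun y : E => (y, unitPt E G)) (x := unitPt E G)
    (cDiffAt_localMul E G 1) rfl
    ((hasDirDeriv_clm (ContinuousLinearMap.id ℝ E) _ x).prodMk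
      (hasDirDeriv_const (unitPt E G) _ x))
  exact h.unique (HasDirDeriv.congr_of_eventuallyEq
    (hasDirDeriv_clm (ContinuousLinearMap.id ℝ E) _ x) (localMul_fst_eventually E G).symm)

/-- Write X_x for the left invariant field with value x at the unit and m for the local
multiplication. Differentiating X_x(p) = dm(e,p)(Ad(p)x, 0) at e along v gives a mixed second
derivative of m plus the derivative W of Ad. By symmetry the mixed term is dX_v(e)(x), so W is the
difference that defines the bracket. -/
theorem dirDeriv_localAd (v x : E) :
    dirDeriv (localAd E G) (unitPt E G, x) (v, 0) = lieBracket E G v x := by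
  set e := unitPt E G
  set W := dirDeriv (localAd E G) (e, x) (v, 0) with hW
  have hm := cDiffAt_localMul E G
  have hd := (hm 2).dirDeriv (x, 0)
  have hlin := hasDirDeriv_clm (ContinuousLinearMap.id ℝ E) e v
  have hA : HasDirDeriv (fun p => localAd E G (p, x)) e v W :=
    CDiffAt.comp_hasDirDeriv_of_eq (g := fun p : E => (p, x)) (cDiffAt_localAd E G x 1) rfl
      (hlin.prodMk (hasDirDeriv_const x e v))
  have h1 : HasDirDeriv (leftInvField E G x) e v
      (dirDeriv (fun p : (E × E) × (E × E) => dirDeriv (localMul E G) p.1 p.2) ((e, e), (x, 0))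
        ((0, v), (W, 0))) := by
    have := CDiffAt.comp_hasDirDeriv_of_eq (x := e)
      (g := fun p : E => ((e, p), (localAd E G (p, x), (0 : E)))) hd
      (by simp [e]) (((hasDirDeriv_const e e v).prodMk hlin).prodMk
        (hA.prodMk (hasDirDeriv_const 0 e v)))
    refine this.congr_of_eventuallyEq ?_
    filter_upwards [leftInvField_eventually_eq E G x] with p hp
    exact hp.symm
  have h2 : dirDeriv (fun p : (E × E) × (E × E) => dirDeriv (localMul E G) p.1 p.2)
      ((e, e), (x, 0)) ((0, v), (W, 0)) =
      dirDeriv (leftInvField E G v) e x + W := by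
    have hs : (((0, v), (W, 0)) : (E × E) × (E × E)) = ((0, v), 0) + (0, (W, 0)) := by simp
    rw [hs, hd.dirDeriv_add]
    congr 1
    · have h3 : HasDirDeriv (fun p : E × E => dirDeriv (localMul E G) p (x, 0)) (e, e) (0, v)
          (dirDeriv (fun p : (E × E) × (E × E) => dirDeriv (localMul E G) p.1 p.2)
            ((e, e), (x, 0)) ((0, v), 0)) :=
        CDiffAt.comp_hasDirDeriv_of_eq (g := fun p : E × E => (p, ((x, 0) : E × E))) hd rfl
          ((hasDirDeriv_clm (ContinuousLinearMap.id ℝ (E × E)) _ _).prodMk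
            (hasDirDeriv_const _ _ _))
      rw [← h3.dirDeriv_eq, (hm 2).dirDeriv_comm]
      have h4 : HasDirDeriv (fun p : E × E => dirDeriv (localMul E G) p (0, v)) (e, e) (x, 0)
          (dirDeriv (fun p : (E × E) × (E × E) => dirDeriv (localMul E G) p.1 p.2)
            ((e, e), (0, v)) ((x, 0), 0)) :=
        CDiffAt.comp_hasDirDeriv_of_eq (g := fun p : E × E => (p, ((0, v) : E × E)))
          ((hm 2).dirDeriv (0, v)) rfl
          ((hasDirDeriv_clm (ContinuousLinearMap.id ℝ (E × E)) _ _).prodMk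
            (hasDirDeriv_const _ _ _))
      rw [h4.dirDeriv_eq]
      have h5 : HasDirDeriv (fun p : E => dirDeriv (localMul E G) (p, e) (0, v)) e x
          (dirDeriv (fun p : (E × E) × (E × E) => dirDeriv (localMul E G) p.1 p.2)
            ((e, e), (0, v)) ((x, 0), 0)) :=
        CDiffAt.comp_hasDirDeriv_of_eq (g := fun p : E => ((p, e), ((0, v) : E × E)))
          ((hm 2).dirDeriv (0, v)) rfl
          (((hasDirDeriv_clm (ContinuousLinearMap.id ℝ E) _ _).prodMk
            (hasDirDeriv_const _ _ _)).prodMk (hasDirDeriv_const _ _ _))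
      simp only [e, dirDeriv_localMul_snd] at h5
      exact h5.dirDeriv_eq.symm
    · have h6 : HasDirDeriv (fun y : E => dirDeriv (localMul E G) (e, e) (y, 0)) x W
          (dirDeriv (fun p : (E × E) × (E × E) => dirDeriv (localMul E G) p.1 p.2)
            ((e, e), (x, 0)) (0, (W, 0))) :=
        CDiffAt.comp_hasDirDeriv_of_eq (g := fun y : E => ((e, e), (y, (0 : E)))) hd rfl
          ((hasDirDeriv_const _ _ _).prodMk
            ((hasDirDeriv_clm (ContinuousLinearMap.id ℝ E) _ _).prodMk (hasDirDeriv_const _ _ _)))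
      simp only [e, dirDeriv_localMul_fst] at h6
      exact h6.unique (hasDirDeriv_clm (ContinuousLinearMap.id ℝ E) _ _)
  have h7 := h1.dirDeriv_eq
  rw [h2] at h7
  rw [lieBracket]
  exact eq_sub_of_add_eq' h7.symm

variable {E G}

/-- The product rule for the adjoint action along curves. -/
theorem HasVelocity.hasDirDeriv_adCLM {c : ℝ → G} {v : E} (hc : HasVelocity E G c v) {z : ℝ → E}
    {z' : E} (hz : HasDirDeriv z 0 1 z') :
    HasDirDeriv (fun t => adCLM E (c t) (z t)) 0 1 (lieBracket E G v (z 0) + z') := by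
  have h := CDiffAt.comp_hasDirDeriv_of_eq (g := fun t : ℝ => (unitChart E G (c t), z t)) (x := 0)
    (cDiffAt_localAd E G (z 0) 1) (by simp [hc.1]) (hc.2.2.prodMk hz)
  have h1 : dirDeriv (localAd E G) (unitPt E G, z 0) (v, z') = lieBracket E G v (z 0) + z' := by
    have hs : ((v, z') : E × E) = (v, 0) + (0, z') := by simp
    rw [hs, (cDiffAt_localAd E G (z 0) 1).dirDeriv_add, dirDeriv_localAd]
    congr 1
    have h2 := CDiffAt.comp_hasDirDeriv_of_eq (g := fun y : E => (unitPt E G, y)) (x := z 0)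
      (cDiffAt_localAd E G (z 0) 1) rfl ((hasDirDeriv_const (unitPt E G) _ z').prodMk
        (hasDirDeriv_clm (ContinuousLinearMap.id ℝ E) _ z'))
    simp only [localAd_unitPt] at h2
    exact h2.unique (hasDirDeriv_clm (ContinuousLinearMap.id ℝ E) _ _)
  rw [h1] at h
  refine h.congr_of_eventuallyEq ?_
  filter_upwards [hc.2.1] with t ht
  simp [localAd, (unitChart E G).left_inv ht]

theorem HasVelocity.hasDirDeriv_adCLM_const {c : ℝ → G} {v : E} (hc : HasVelocity E G c v)
    (x : E) : HasDirDeriv (fun t => adCLM E (c t) x) 0 1 (lieBracket E G v x) := by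
  simpa using hc.hasDirDeriv_adCLM (hasDirDeriv_const x (0 : ℝ) 1)

theorem lieBracket_antisymm (x y : E) : lieBracket E G x y = - lieBracket E G y x := by
  simp [lieBracket]

variable (G) in
/-- `x ↦ [x, y]` as a continuous linear map. -/
noncomputable def bracketRight (y : E) : E →L[ℝ] E :=
  (cDiffAt_localAd E G y 1).clm.comp (ContinuousLinearMap.inl ℝ E E)

theorem bracketRight_apply (x y : E) : bracketRight G y x = lieBracket E G x y :=
  dirDeriv_localAd E G x y

variable (G) in
/-- `y ↦ [x, y]` as a continuous linear map. -/
noncomputable def bracketLeft (x : E) : E →L[ℝ] E := -bracketRight G x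

theorem bracketLeft_apply (x y : E) : bracketLeft G x y = lieBracket E G x y := by
  rw [lieBracket_antisymm, ← bracketRight_apply]; rfl

/-- Differentiate Ad(g) Ad(c(t)) y = Ad(g c(t) g⁻¹) Ad(g) y at t = 0. -/
theorem adCLM_lieBracket (g : G) (x y : E) :
    adCLM E g (lieBracket E G x y) = lieBracket E G (adCLM E g x) (adCLM E g y) := by
  obtain ⟨c, hc⟩ := exists_hasVelocity (G := G) x
  refine ((hc.hasDirDeriv_adCLM_const y).clm_comp (adCLM E g)).unique ?_
  convert (hc.conj g).hasDirDeriv_adCLM_const (adCLM E g y) using 2 with t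
  simp [adCLM_mul_apply]

/-- Differentiating the constant Ad(c(t)) Ad(c(t)⁻¹) x gives this without computing the derivative
of the inversion. -/
theorem lieBracket_inv_velocity {c : ℝ → G} {v w : E} (hc : HasVelocity E G c v)
    (hw : HasVelocity E G (fun t => (c t)⁻¹) w) (x : E) :
    lieBracket E G w x = - lieBracket E G v x := by
  have h := hc.hasDirDeriv_adCLM (hw.hasDirDeriv_adCLM_const x)
  simp only [adCLM_apply_inv_self, hc.1, inv_one, adCLM_one_apply] at h
  exact (neg_eq_of_add_eq_zero_right ((hasDirDeriv_const x (0 : ℝ) 1).unique h).symm).symm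

end Bracket

/-! ### Consequences of connectedness -/

section Connected

variable {E : Type u} [AddCommGroup E] [Module ℝ E] [TopologicalSpace E]
  [IsTopologicalAddGroup E] [ContinuousSMul ℝ E] [LocallyConvexSpace ℝ E] [T2Space E]
  {G : Type v} [Group G] [TopologicalSpace G] [ChartedSpace E G] [LocallyConvexLieGroup E G]

theorem exists_clm_vanishing_on {M : Submodule ℝ E} (hM : IsClosed (M : Set E)) {x : E}
    (hx : x ∉ M) : ∃ β : E →L[ℝ] ℝ, (∀ y ∈ M, β y = 0) ∧ β x ≠ 0 := by
  obtain ⟨β, c, hβ, hc⟩ := geometric_hahn_banach_closed_point (s := (M : Set E)) M.convex hM hx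
  have h0 : 0 < c := by simpa using hβ 0 M.zero_mem
  have hz : ∀ y ∈ M, β y = 0 := by
    intro y hy
    by_contra hne
    -- The multiple of y on which β equals c contradicts the strict bound β < c on M.
    have := hβ _ (M.smul_mem (c / β y) hy)
    simp [div_mul_cancel₀ c hne] at this
  exact ⟨β, hz, (h0.trans hc).ne'⟩

/-- Near g, join points to g by segments in a convex part of the chart. The function has zero
derivative along each segment, so it is locally constant, and connectedness concludes. -/
theorem eq_apply_one_of_velocity [ConnectedSpace G] {f : G → ℝ}
    (hf : ∀ (g : G) (c : ℝ → G) (w : E), HasVelocity E G c w →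
      HasDirDeriv (fun t => f (c t * g)) 0 1 0) (g : G) : f g = f 1 := by
  have : IsTopologicalGroup G := LocallyConvexLieGroup.toIsTopologicalGroup E
  refine IsLocallyConstant.apply_eq_of_preconnectedSpace
    ((IsLocallyConstant.iff_eventually_eq f).2 fun g => ?_) g 1
  obtain ⟨C, ⟨hC, hCc⟩, hCt⟩ := (LocallyConvexSpace.convex_basis (𝕜 := ℝ) (unitPt E G)).mem_iff.1
    ((unitChart E G).open_target.mem_nhds (unitPt_mem E G))
  have hs : (unitChart E G).source ∈ 𝓝 (1 : G) :=
    (unitChart E G).open_source.mem_nhds (mem_chart_source E 1)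
  have hC' : ∀ᶠ y in 𝓝 (1 : G), unitChart E G y ∈ C :=
    (unitChart E G).continuousAt (mem_chart_source E 1) hC
  have ht : Tendsto (fun y => y * g⁻¹) (𝓝 g) (𝓝 1) :=
    Continuous.tendsto' (by fun_prop) _ _ (mul_inv_cancel g)
  filter_upwards [ht hs, ht hC'] with y hy1 hy2
  set d := unitChart E G (y * g⁻¹) - unitPt E G with hd
  set F : ℝ → ℝ := fun t => f ((unitChart E G).symm (unitPt E G + t • d) * g) with hF
  have key : ∀ t ∈ Icc (0 : ℝ) 1, HasDerivAt F 0 t := by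
    intro t ht
    have hm : unitPt E G + t • d ∈ (unitChart E G).target :=
      hCt (hCc.add_smul_sub_mem (mem_of_mem_nhds hC) hy2 ht)
    set k := (unitChart E G).symm (unitPt E G + t • d) with hk
    -- Right translation by k⁻¹ moves the segment at time t to a curve through 1, so the hypothesis
    -- applies at the base point k * g.
    have hv := ((gSmoothAt_symm (chart_mem_atlas E (1 : G)) hm).mul
      (gSmoothAt_const k⁻¹ _)).exists_hasVelocity (by simp [k])
      (c := fun s => (unitPt E G + t • d) + s • d) (by simp) (by fun_prop) (hasDirDeriv_line _ d)
    refine hasDirDeriv_real_iff.1 ?_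
    refine Tendsto.congr (fun s => ?_) (hf (k * g) _ _ hv)
    simp [F, add_smul, add_assoc, mul_assoc]
  have h01 := constant_of_has_deriv_right_zero (f := F) (a := 0) (b := 1)
    (fun t ht => (key t ht).continuousAt.continuousWithinAt)
    (fun t ht => (key t (Ico_subset_Icc_self ht)).hasDerivWithinAt) 1 (by simp)
  have h1 : (unitChart E G).symm (unitPt E G + (1 : ℝ) • d) = y * g⁻¹ := by
    rw [one_smul, hd, add_sub_cancel]
    exact (unitChart E G).left_inv hy1
  simp only [F, h1] at h01
  simpa using h01

/-- A functional vanishing on M is constant along the Ad-orbit of x. Since M is recovered from such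
functionals only when closed, the filtration used below consists of closures. -/
theorem adCLM_sub_mem [ConnectedSpace G] {M : Submodule ℝ E} (hM : IsClosed (M : Set E)) {x : E}
    (h : ∀ (g : G) (v : E), lieBracket E G v (adCLM E g x) ∈ M) (g : G) :
    adCLM E g x - x ∈ M := by
  by_contra hn
  obtain ⟨β, hβ, hne⟩ := exists_clm_vanishing_on hM hn
  refine hne ?_
  have := eq_apply_one_of_velocity (E := E) (f := fun g : G => β (adCLM E g x))
    (fun g c w hc => ?_) g
  · simpa [sub_eq_zero] using this
  · have h1 := (hc.hasDirDeriv_adCLM_const (adCLM E g x)).clm_comp β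
    rw [hβ _ (h g w)] at h1
    simpa only [adCLM_mul_apply] using h1

end Connected

/-! ### The closed descending central series -/

section CentralSeries

variable (E : Type u) [AddCommGroup E] [Module ℝ E] [TopologicalSpace E]
  [IsTopologicalAddGroup E] [ContinuousSMul ℝ E] [LocallyConvexSpace ℝ E] [T2Space E]
  (G : Type v) [Group G] [TopologicalSpace G] [ChartedSpace E G] [LocallyConvexLieGroup E G]

/-- The closures of the terms of the descending central series. -/
def closedCentralSeries (j : ℕ) : Submodule ℝ E := Submodule.topologicalClosure (centralSeries E G j)

variable {E G}

theorem isClosed_closedCentralSeries (j : ℕ) : IsClosed (closedCentralSeries E G j : Set E) :=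
  Submodule.isClosed_topologicalClosure _

theorem centralSeries_le_closed (j : ℕ) : centralSeries E G j ≤ closedCentralSeries E G j :=
  Submodule.le_topologicalClosure _

theorem mem_closedCentralSeries_zero (x : E) : x ∈ closedCentralSeries E G 0 :=
  centralSeries_le_closed 0 (Submodule.mem_top (x := x))

theorem lieBracket_mem_centralSeries {j : ℕ} (v : E) {x : E} (hx : x ∈ centralSeries E G j) :
    lieBracket E G v x ∈ centralSeries E G (j + 1) :=
  Submodule.subset_span ⟨v, Submodule.mem_top, x, hx, rfl⟩

theorem lieBracket_mem_closed {j : ℕ} (v : E) {x : E} (hx : x ∈ closedCentralSeries E G j) :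
    lieBracket E G v x ∈ closedCentralSeries E G (j + 1) := by
  rw [← bracketLeft_apply]
  refine map_mem_closure (bracketLeft G v).continuous hx fun y hy => ?_
  rw [bracketLeft_apply]
  exact lieBracket_mem_centralSeries v hy

theorem centralSeries_succ_le (j : ℕ) : centralSeries E G (j + 1) ≤ centralSeries E G j := by
  induction j with
  | zero => exact le_top
  | succ j ih =>
    refine Submodule.span_le.2 ?_
    rintro _ ⟨x, _, y, hy, rfl⟩
    exact lieBracket_mem_centralSeries x (ih hy)

theorem closedCentralSeries_antitone : Antitone (closedCentralSeries E G) :=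
  antitone_nat_of_succ_le fun j => Submodule.topologicalClosure_mono (centralSeries_succ_le j)

theorem adCLM_mem_centralSeries (g : G) (j : ℕ) {x : E} (hx : x ∈ centralSeries E G j) :
    adCLM E g x ∈ centralSeries E G j := by
  induction j generalizing x with
  | zero => exact Submodule.mem_top
  | succ j ih =>
    suffices h : centralSeries E G (j + 1) ≤
        (centralSeries E G (j + 1)).comap (adCLM E g).toLinearMap from h hx
    refine Submodule.span_le.2 ?_
    rintro _ ⟨x, _, y, hy, rfl⟩
    change adCLM E g (lieBracket E G x y) ∈ centralSeries E G (j + 1)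
    rw [adCLM_lieBracket]
    exact lieBracket_mem_centralSeries _ (ih hy)

theorem adCLM_mem_closed (g : G) {j : ℕ} {x : E} (hx : x ∈ closedCentralSeries E G j) :
    adCLM E g x ∈ closedCentralSeries E G j :=
  map_mem_closure (adCLM E g).continuous hx fun _ hy => adCLM_mem_centralSeries g j hy

theorem adCLM_sub_mem_closed [ConnectedSpace G] (g : G) {j : ℕ} {x : E}
    (hx : x ∈ closedCentralSeries E G j) : adCLM E g x - x ∈ closedCentralSeries E G (j + 1) :=
  adCLM_sub_mem (isClosed_closedCentralSeries _)
    (fun g v => lieBracket_mem_closed v (adCLM_mem_closed g hx)) g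

variable (G) in
/-- Operators raising the index of the closed central series by `i`. -/
def RaisesBy (i : ℕ) (T : E →L[ℝ] E) : Prop :=
  ∀ j, ∀ x ∈ closedCentralSeries E G j, T x ∈ closedCentralSeries E G (j + i)

theorem RaisesBy.mono {i k : ℕ} {T : E →L[ℝ] E} (h : RaisesBy G k T) (hik : i ≤ k) :
    RaisesBy G i T := fun j x hx => closedCentralSeries_antitone (by omega) (h j x hx)

theorem RaisesBy.add {i : ℕ} {S T : E →L[ℝ] E} (hS : RaisesBy G i S) (hT : RaisesBy G i T) :
    RaisesBy G i (S + T) := fun j x hx => add_mem (hS j x hx) (hT j x hx)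

theorem RaisesBy.sub {i : ℕ} {S T : E →L[ℝ] E} (hS : RaisesBy G i S) (hT : RaisesBy G i T) :
    RaisesBy G i (S - T) := fun j x hx => sub_mem (hS j x hx) (hT j x hx)

theorem RaisesBy.comp {i k : ℕ} {S T : E →L[ℝ] E} (hS : RaisesBy G i S) (hT : RaisesBy G k T) :
    RaisesBy G (k + i) (S.comp T) := fun j x hx => by
  rw [← add_assoc]; exact hS _ _ (hT j x hx)

theorem raisesBy_adCLM (g : G) : RaisesBy G 0 (adCLM E g) := fun _ _ hx => adCLM_mem_closed g hx

variable (E) in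
/-- The operator `Ad(g) - 1`. -/
noncomputable def adSubOne (g : G) : E →L[ℝ] E := adCLM E g - ContinuousLinearMap.id ℝ E

theorem adSubOne_apply (g : G) (x : E) : adSubOne E g x = adCLM E g x - x := rfl

theorem raisesBy_adSubOne [ConnectedSpace G] (g : G) : RaisesBy G 1 (adSubOne E g) :=
  fun _ _ hx => adCLM_sub_mem_closed g hx

/-- The operator `Ad(a) T Ad(a)⁻¹ - T`. -/
noncomputable def twist (a : G) (T : E →L[ℝ] E) : E →L[ℝ] E :=
  (adCLM E a).comp (T.comp (adCLM E a⁻¹)) - T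

theorem twist_apply (a : G) (T : E →L[ℝ] E) (x : E) :
    twist a T x = adCLM E a (T (adCLM E a⁻¹ x)) - T x := rfl

theorem RaisesBy.twist [ConnectedSpace G] {i : ℕ} {T : E →L[ℝ] E} (hT : RaisesBy G i T) (a : G) :
    RaisesBy G (i + 1) (twist a T) := by
  -- Each of N_a T and T N_a raises the index by one more than T, and Ad(a⁻¹) preserves it.
  have h : LCLie.twist a T =
      ((adSubOne E a).comp T - T.comp (adSubOne E a)).comp (adCLM E a⁻¹) := by
    ext x; simp [twist_apply, adSubOne_apply]
  rw [h]
  have h1 := (raisesBy_adSubOne (E := E) a).comp hT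
  have h2 := hT.comp (raisesBy_adSubOne (E := E) a)
  rw [add_comm] at h2
  simpa using (h1.sub h2).comp (raisesBy_adCLM a⁻¹)

theorem twist_add (a : G) (S T : E →L[ℝ] E) : twist a (S + T) = twist a S + twist a T := by
  ext x; simp only [twist_apply, add_apply, map_add]; abel

theorem twist_smul (a : G) (r : ℝ) (T : E →L[ℝ] E) : twist a (r • T) = r • twist a T := by
  ext x; simp [twist_apply, smul_sub]

theorem twist_adSubOne (a k : G) :
    twist a (adSubOne E k) = (adSubOne E (a * k * a⁻¹ * k⁻¹)).comp (adCLM E k) := by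
  ext x; simp [twist_apply, adSubOne_apply, ← adCLM_mul_apply, mul_assoc]

theorem twist_bracketLeft (a : G) (w : E) :
    twist a (bracketLeft G w) = bracketLeft G (adCLM E a w - w) := by
  ext x
  rw [twist_apply, bracketLeft_apply, bracketLeft_apply, adCLM_lieBracket, adCLM_apply_inv_self,
    bracketLeft_apply, ← bracketRight_apply, ← bracketRight_apply, ← bracketRight_apply, map_sub]

end CentralSeries

/-! ### Invariant semi-equicontinuous sets of functionals -/

section Orbit

variable {E : Type u} [AddCommGroup E] [Module ℝ E] [TopologicalSpace E]
  [IsTopologicalAddGroup E] [ContinuousSMul ℝ E] [LocallyConvexSpace ℝ E] [T2Space E]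
  {G : Type v} [Group G] [TopologicalSpace G] [ChartedSpace E G] [LocallyConvexLieGroup E G]
  {O : Set (E →L[ℝ] ℝ)}

variable (G) in
/-- All `s`-fold iterated twists of `T` are annihilated by `O`. -/
def TwistKilled (O : Set (E →L[ℝ] ℝ)) : ℕ → (E →L[ℝ] E) → Prop
  | 0, T => ∀ μ ∈ O, ∀ x, μ (T x) = 0
  | s + 1, T => ∀ a : G, TwistKilled O s (twist a T)

theorem TwistKilled.add {s : ℕ} : ∀ {S T : E →L[ℝ] E}, TwistKilled G O s S →
    TwistKilled G O s T → TwistKilled G O s (S + T) := by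
  induction s with
  | zero => intro S T hS hT μ hμ x; simp [hS μ hμ x, hT μ hμ x]
  | succ s ih => intro S T hS hT a; rw [twist_add]; exact ih (hS a) (hT a)

theorem TwistKilled.smul {s : ℕ} (c : ℝ) : ∀ {T : E →L[ℝ] E}, TwistKilled G O s T →
    TwistKilled G O s (c • T) := by
  induction s with
  | zero => intro T hT μ hμ x; simp [hT μ hμ x]
  | succ s ih => intro T hT a; rw [twist_smul]; exact ih (hT a)

theorem TwistKilled.of_tendsto {ι : Type*} {l : Filter ι} [l.NeBot] {s : ℕ} :
    ∀ {T : ι → E →L[ℝ] E} {D : E →L[ℝ] E}, (∀ x, Tendsto (fun i => T i x) l (𝓝 (D x))) →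
      (∀ i, TwistKilled G O s (T i)) → TwistKilled G O s D := by
  induction s with
  | zero =>
    intro T D h hT μ hμ x
    refine tendsto_nhds_unique ((μ.continuous.tendsto _).comp (h x)) ?_
    refine tendsto_const_nhds.congr fun i => ?_
    exact (hT i μ hμ x).symm
  | succ s ih =>
    intro T D h hT a
    refine ih (T := fun i => twist a (T i)) (fun x => ?_) fun i => hT i a
    exact (((adCLM E a).continuous.tendsto _).comp (h _)).sub (h x)

/-- ad v is the pointwise limit of N_{c(t)}/t, and the condition is linear and stable under
pointwise limits. -/
theorem TwistKilled.bracketLeft {s : ℕ} (h : ∀ g : G, TwistKilled G O s (adSubOne E g)) (v : E) :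
    TwistKilled G O s (bracketLeft G v) := by
  obtain ⟨c, hc⟩ := exists_hasVelocity (G := G) v
  refine TwistKilled.of_tendsto (l := 𝓝[≠] (0 : ℝ)) (T := fun t => t⁻¹ • adSubOne E (c t))
    (fun x => ?_) fun t => (h (c t)).smul t⁻¹
  rw [bracketLeft_apply]
  refine Tendsto.congr (fun t => ?_) (hc.hasDirDeriv_adCLM_const x)
  simp [adSubOne_apply, hc.1]

/-- One twist is traded for one bracket: twisting ad w by c(t) gives ad(Ad(c(t))w - w), whose
quotient by t tends to ad [v,w]. -/
theorem TwistKilled.lieBracket {s : ℕ} {w : E}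
    (h : TwistKilled G O (s + 1) (LCLie.bracketLeft G w)) (v : E) :
    TwistKilled G O s (LCLie.bracketLeft G (lieBracket E G v w)) := by
  obtain ⟨c, hc⟩ := exists_hasVelocity (G := G) v
  refine TwistKilled.of_tendsto (l := 𝓝[≠] (0 : ℝ))
    (T := fun t => t⁻¹ • twist (c t) (LCLie.bracketLeft G w)) (fun x => ?_) fun t => (h (c t)).smul t⁻¹
  have h1 : Tendsto (fun t : ℝ => bracketRight G x (t⁻¹ • (adCLM E (c t) w - w))) (𝓝[≠] 0)
      (𝓝 (bracketRight G x (LCLie.lieBracket E G v w))) := by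
    refine ((bracketRight G x).continuous.tendsto _).comp ?_
    refine Tendsto.congr (fun t => ?_) (hc.hasDirDeriv_adCLM_const w)
    simp [hc.1]
  rw [bracketLeft_apply, ← bracketRight_apply]
  refine h1.congr fun t => ?_
  rw [twist_bracketLeft, map_smul, bracketRight_apply, ← bracketLeft_apply]; rfl

theorem bracketLeft_add (v w : E) :
    LCLie.bracketLeft G (v + w) = LCLie.bracketLeft G v + LCLie.bracketLeft G w := by
  ext x
  simp only [add_apply, bracketLeft_apply, ← bracketRight_apply, map_add]

theorem bracketLeft_smul (r : ℝ) (w : E) :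
    LCLie.bracketLeft G (r • w) = r • LCLie.bracketLeft G w := by
  ext x
  simp only [smul_apply, bracketLeft_apply, ← bracketRight_apply, map_smul]

theorem TwistKilled.bracketLeft_centralSeries {j : ℕ} :
    ∀ {s : ℕ}, (∀ g : G, TwistKilled G O (s + j) (adSubOne E g)) →
      ∀ w ∈ centralSeries E G j, TwistKilled G O s (LCLie.bracketLeft G w) := by
  induction j with
  | zero => intro s h w _; exact TwistKilled.bracketLeft h w
  | succ j ih =>
    intro s h w hw
    have ih' := ih (s := s + 1) (by simpa only [add_assoc, add_comm 1 j] using h)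
    induction hw using Submodule.span_induction with
    | mem x hx =>
      obtain ⟨v, _, y, hy, rfl⟩ := hx
      exact (ih' y hy).lieBracket v
    | zero =>
      -- The zero vector is treated as the bracket [0,0].
      have h0 := (ih' 0 (zero_mem _)).lieBracket 0
      rwa [← bracketLeft_apply, map_zero] at h0
    | add x y _ _ hx hy => rw [bracketLeft_add]; exact hx.add hy
    | smul r x _ hx => rw [bracketLeft_smul]; exact hx.smul r

/-- `O` vanishes on the `j`-th term of the descending central series. -/
def KillsCentral (G : Type v) [Group G] [TopologicalSpace G] [ChartedSpace E G]
    (O : Set (E →L[ℝ] ℝ)) (j : ℕ) : Prop :=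
  ∀ μ ∈ O, ∀ x ∈ centralSeries E G j, μ x = 0

theorem KillsCentral.closed {j : ℕ} (h : KillsCentral G O j) {μ : E →L[ℝ] ℝ} (hμ : μ ∈ O) {x : E}
    (hx : x ∈ closedCentralSeries E G j) : μ x = 0 :=
  closure_minimal (s := (centralSeries E G j : Set E)) (t := {x | μ x = 0}) (h μ hμ)
    (isClosed_eq μ.continuous continuous_const) hx

theorem killsCentral_of_twistKilled {r : ℕ} (h : ∀ g : G, TwistKilled G O r (adSubOne E g)) :
    KillsCentral G O (r + 1) := by
  intro μ hμ x hx
  have h1 := TwistKilled.bracketLeft_centralSeries (j := r) (s := 0) (by simpa using h)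
  suffices hle : centralSeries E G (r + 1) ≤ LinearMap.ker μ.toLinearMap from hle hx
  refine Submodule.span_le.2 ?_
  rintro _ ⟨x, _, y, hy, rfl⟩
  have := h1 y hy μ hμ x
  rw [bracketLeft_apply] at this
  change μ (lieBracket E G x y) = 0
  rw [lieBracket_antisymm, map_neg, this, neg_zero]

/-! ### The one-sided bound and the descent along the central series. -/

theorem eq_add_mul_of_succ_sub {F : ℤ → ℝ} {c : ℝ} (h : ∀ j, F (j + 1) - F j = c) (j : ℤ) :
    F j = F 0 + j * c := by
  induction j using Int.induction_on with
  | zero => simp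
  | succ i ih => have := h i; push_cast at *; linarith
  | pred i ih => have := h (-i - 1); simp only [sub_add_cancel] at this; push_cast at *; linarith

theorem eq_zero_of_forall_int_mul_le {a b c : ℝ} (h : ∀ j : ℤ, a + j * c ≤ b) : c = 0 := by
  by_contra hc
  obtain ⟨n, hn⟩ := exists_nat_gt ((b - a) / |c|)
  have hc' := abs_pos.2 hc
  rw [div_lt_iff₀ hc'] at hn
  have h1 := h n
  have h2 := h (-n)
  push_cast at h1 h2
  rcases abs_cases c with ⟨h3, _⟩ | ⟨h3, _⟩ <;> rw [h3] at hn <;> linarith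

theorem adSubOne_killed_of_sq_killed (hO : ∀ μ ∈ O, ∀ g : G, μ.comp (adCLM E g) ∈ O)
    (hs : SemiEquicontinuous E O) {k : G}
    (hk : ∀ μ ∈ O, ∀ x, μ (adSubOne E k (adSubOne E k x)) = 0) :
    ∀ μ ∈ O, ∀ x, μ (adSubOne E k x) = 0 := by
  obtain ⟨x₀, U, hU, C, hC⟩ := hs
  have hbd : ∀ x ∈ U, ∀ μ ∈ O, μ (-x) ≤ C := fun x hx μ hμ =>
    EReal.coe_le_coe_iff.1 ((le_iSup₂ (f := fun α (_ : α ∈ O) => ((α (-x) : ℝ) : EReal)) μ hμ).trans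
      (hC x hx))
  intro μ hμ
  have hUz : ∀ x ∈ U, μ (adSubOne E k x) = 0 := by
    intro x hx
    -- O is invariant, so the hypothesis on N_k² also holds for μ ∘ Ad(k^j); the increments of j ↦
    -- μ(Ad(k^j)x) are therefore all equal.
    have hconst : ∀ j : ℤ, μ (adCLM E (k ^ j) (adSubOne E k x)) = μ (adSubOne E k x) := by
      intro j
      have := eq_add_mul_of_succ_sub (F := fun j : ℤ => μ (adCLM E (k ^ j) (adSubOne E k x)))
        (c := 0) (fun j => ?_) j
      · simpa using this
      · have := hk _ (hO μ hμ (k ^ j)) x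
        rw [adSubOne_apply, map_sub] at this
        rw [zpow_add_one, adCLM_mul_apply]
        exact this
    have hlin := eq_add_mul_of_succ_sub (F := fun j : ℤ => μ (adCLM E (k ^ j) x))
      (c := μ (adSubOne E k x)) (fun j => by
        rw [← hconst j, adSubOne_apply, zpow_add_one, adCLM_mul_apply, map_sub, map_sub])
    have h0 : -μ (adSubOne E k x) = 0 := by
      refine eq_zero_of_forall_int_mul_le (a := -μ x) (b := C) fun j => ?_
      have h1 := hbd x hx _ (hO μ hμ (k ^ j))
      have h2 := hlin j
      simp only [ContinuousLinearMap.comp_apply, map_neg] at h1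
      simp only [zpow_zero, adCLM_one_apply] at h2
      linarith
    linarith
  -- Vanishing at x₀ and at x₀ + t x for some t ≠ 0 forces vanishing at x.
  intro x
  have ht := (tendsto_line x₀ x hU)
  have hne : ∀ᶠ t in 𝓝[≠] (0 : ℝ), x₀ + t • x ∈ U := nhdsWithin_le_nhds ht
  obtain ⟨t, ht, ht0⟩ := (hne.and self_mem_nhdsWithin).exists
  have h1 := hUz _ ht
  have h2 := hUz _ (mem_of_mem_nhds hU)
  simp only [map_add, map_smul, h2, zero_add, smul_eq_mul] at h1
  exact (mul_eq_zero.1 h1).resolve_left ht0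

/-- Twists are linear in T, as differentiation requires, but a twist of N_k is N of a commutator
only up to higher order. The induction therefore carries T together with a group element k for which
N_k has the same leading part. -/
theorem KillsCentral.twistKilled [ConnectedSpace G] (hO : ∀ μ ∈ O, ∀ g : G, μ.comp (adCLM E g) ∈ O)
    (hs : SemiEquicontinuous E O) {m : ℕ} (h : KillsCentral G O (m + 2)) {s : ℕ} :
    ∀ {i : ℕ} {T : E →L[ℝ] E} {k : G}, i + s = m + 1 → 1 ≤ i → RaisesBy G i T →
      RaisesBy G (i + 1) (T - adSubOne E k) → TwistKilled G O s T := by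
  induction s with
  | zero =>
    intro i T k hi _ hT hTk μ hμ x
    obtain rfl : i = m + 1 := by omega
    have hN : RaisesBy G (m + 1) (adSubOne E k) := by
      simpa using hT.sub (hTk.mono (Nat.le_succ _))
    have h1 : μ (T x - adSubOne E k x) = 0 :=
      h.closed hμ (by simpa using hTk 0 x (mem_closedCentralSeries_zero x))
    -- N_k² raises the index by 2(m + 1) ≥ m + 2, so O kills it.
    have h2 := adSubOne_killed_of_sq_killed hO hs (k := k) (fun ν hν y => h.closed hν
      (closedCentralSeries_antitone (by omega)
        (hN _ _ (hN 0 y (mem_closedCentralSeries_zero y))))) μ hμ x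
    rw [map_sub, h2, sub_zero] at h1
    exact h1
  | succ s ih =>
    intro i T k hi hi1 hT hTk a
    have hN : RaisesBy G i (adSubOne E k) := by
      simpa using hT.sub (hTk.mono (Nat.le_succ _))
    have hN' : RaisesBy G (i + 1) (adSubOne E (a * k * a⁻¹ * k⁻¹)) := by
      have : adSubOne E (a * k * a⁻¹ * k⁻¹) = (twist a (adSubOne E k)).comp (adCLM E k⁻¹) := by
        ext x; rw [twist_adSubOne]; simp
      rw [this]
      simpa using (hN.twist a).comp (raisesBy_adCLM k⁻¹)
    refine ih (i := i + 1) (k := a * k * a⁻¹ * k⁻¹) (by omega) (by omega) (hT.twist a) ?_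
    -- With k' the commutator of a and k, the twist of N_k is N_{k'}(1 + N_k). The error N_{k'} N_k
    -- raises by 2i + 1 ≥ i + 2, which is where 1 ≤ i is needed.
    have : twist a T - adSubOne E (a * k * a⁻¹ * k⁻¹) = twist a (T - adSubOne E k) +
        (adSubOne E (a * k * a⁻¹ * k⁻¹)).comp (adSubOne E k) := by
      have h1 : twist a T = twist a (T - adSubOne E k) + twist a (adSubOne E k) := by
        rw [← twist_add, sub_add_cancel]
      rw [h1, twist_adSubOne]
      ext x
      simp [adSubOne_apply]
      abel
    rw [this]
    exact (hTk.twist a).add ((hN'.comp hN).mono (by omega))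

theorem KillsCentral.pred [ConnectedSpace G] (hO : ∀ μ ∈ O, ∀ g : G, μ.comp (adCLM E g) ∈ O)
    (hs : SemiEquicontinuous E O) {m : ℕ} (h : KillsCentral G O (m + 2)) :
    KillsCentral G O (m + 1) :=
  killsCentral_of_twistKilled fun g => h.twistKilled hO hs (i := 1) (k := g) (by omega) le_rfl
    (raisesBy_adSubOne g) fun j x _ => by simp

theorem killsCentral_one_of_isNilpotentLie [ConnectedSpace G]
    (hO : ∀ μ ∈ O, ∀ g : G, μ.comp (adCLM E g) ∈ O) (hs : SemiEquicontinuous E O)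
    (h : IsNilpotentLie E G) : KillsCentral G O 1 := by
  obtain ⟨n, hn⟩ := h
  have key : ∀ n, KillsCentral G O n → KillsCentral G O 1 := by
    intro n
    induction n with
    | zero => exact fun h μ hμ x hx => h μ hμ x (centralSeries_succ_le 0 hx)
    | succ n ih =>
      cases n with
      | zero => exact id
      | succ m => exact fun h => ih (h.pred hO hs)
  refine key n fun μ _ x hx => ?_
  rw [hn, Submodule.mem_bot] at hx
  rw [hx, map_zero]

/-! ### The two-step solvable case. -/

theorem lieBracket_closed_eq_zero (h : IsTwoStepSolvable E G) {x y : E}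
    (hx : x ∈ closedCentralSeries E G 1) (hy : y ∈ closedCentralSeries E G 1) :
    lieBracket E G x y = 0 := by
  have h0 : ∀ x ∈ centralSeries E G 1, ∀ y ∈ centralSeries E G 1, lieBracket E G x y = 0 := by
    intro x hx y hy
    have : lieBracket E G x y ∈ derivedSeries E G 2 := Submodule.subset_span ⟨x, hx, y, hy, rfl⟩
    rwa [h, Submodule.mem_bot] at this
  have h1 : ∀ x ∈ centralSeries E G 1, lieBracket E G x y = 0 := by
    intro x hx
    rw [← bracketLeft_apply]
    refine closure_minimal (t := {y | bracketLeft G x y = 0}) (fun y hy => ?_)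
      (isClosed_eq (bracketLeft G x).continuous continuous_const) hy
    exact (bracketLeft_apply x y).trans (h0 x hx y hy)
  rw [← bracketRight_apply]
  refine closure_minimal (t := {x | bracketRight G y x = 0}) (fun x hx => ?_)
    (isClosed_eq (bracketRight G y).continuous continuous_const) hx
  exact (bracketRight_apply x y).trans (h1 x hx)

/-- Let u be the commutator of a and g. Replacing g by c(t)g turns u into (a c(t) a⁻¹) u c(t)⁻¹, so
the derivative is [Ad(a)v - Ad(u)v, Ad(u)z]. Both entries lie in the closure of [𝔤,𝔤], which is
abelian, so the action on z does not depend on g; g = 1 gives the identity. -/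
theorem adCLM_commutator_of_mem [ConnectedSpace G] (h : IsTwoStepSolvable E G) (a g : G) {z : E}
    (hz : z ∈ closedCentralSeries E G 1) : adCLM E (a * g * a⁻¹ * g⁻¹) z = z := by
  have hbot : IsClosed ((⊥ : Submodule ℝ E) : Set E) := by simp
  by_contra hne
  obtain ⟨β, _, hβ⟩ := exists_clm_vanishing_on hbot (x := adCLM E (a * g * a⁻¹ * g⁻¹) z - z)
    (by simpa [sub_eq_zero] using hne)
  refine hβ ?_
  have := eq_apply_one_of_velocity (E := E) (f := fun g : G => β (adCLM E (a * g * a⁻¹ * g⁻¹) z))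
    (fun g c v hc => ?_) g
  · simpa [sub_eq_zero] using this
  · obtain ⟨w, hw⟩ := hc.inv
    set u := a * g * a⁻¹ * g⁻¹
    have h1 := (hc.conj a).hasDirDeriv_adCLM ((hw.hasDirDeriv_adCLM_const z).clm_comp (adCLM E u))
    rw [lieBracket_inv_velocity hc hw, map_neg, adCLM_lieBracket] at h1
    simp only [hc.1, inv_one, adCLM_one_apply] at h1
    have h2 : lieBracket E G (adCLM E a v) (adCLM E u z) +
        -lieBracket E G (adCLM E u v) (adCLM E u z) = 0 := by
      have h3 : adCLM E a v - adCLM E u v ∈ closedCentralSeries E G 1 := by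
        have := sub_mem (adCLM_sub_mem_closed a (mem_closedCentralSeries_zero (G := G) v))
          (adCLM_sub_mem_closed u (mem_closedCentralSeries_zero (G := G) v))
        simpa using this
      have h4 := lieBracket_closed_eq_zero h h3 (adCLM_mem_closed u hz)
      rwa [← bracketRight_apply, map_sub, bracketRight_apply, bracketRight_apply,
        sub_eq_add_neg] at h4
    rw [h2] at h1
    have h5 := h1.clm_comp β
    rw [map_zero] at h5
    convert h5 using 3 with t
    rw [← adCLM_mul_apply, ← adCLM_mul_apply]
    congr 2
    simp [u, mul_assoc]

theorem killsCentral_one_of_isTwoStepSolvable [ConnectedSpace G]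
    (hO : ∀ μ ∈ O, ∀ g : G, μ.comp (adCLM E g) ∈ O) (hs : SemiEquicontinuous E O)
    (h : IsTwoStepSolvable E G) : KillsCentral G O 1 := by
  have key : ∀ g a : G, TwistKilled G O 0 (twist a (adSubOne E g)) := by
    intro g a μ hμ x
    rw [twist_adSubOne]
    have hk : ∀ ν ∈ O, ∀ y, ν (adSubOne E (a * g * a⁻¹ * g⁻¹)
        (adSubOne E (a * g * a⁻¹ * g⁻¹) y)) = 0 := fun ν _ y => by
      have h1 := adCLM_commutator_of_mem h a g
        (adCLM_sub_mem_closed (a * g * a⁻¹ * g⁻¹) (mem_closedCentralSeries_zero (G := G) y))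
      rw [adSubOne_apply _ (adSubOne E _ y), adSubOne_apply, h1, sub_self, map_zero]
    exact adSubOne_killed_of_sq_killed hO hs hk μ hμ (adCLM E g x)
  -- A single twist is killed, so O vanishes on C³(𝔤); the descent step with m = 0 then reaches
  -- [𝔤,𝔤].
  have h2 : KillsCentral G O 2 := killsCentral_of_twistKilled (r := 1) key
  exact h2.pred hO hs

/-! ### Application to coadjoint orbits. -/

theorem comp_adCLM_mem_coadjointOrbit {lam μ : E →L[ℝ] ℝ} (hμ : μ ∈ coadjointOrbit E G lam)
    (g : G) : μ.comp (adCLM E g) ∈ coadjointOrbit E G lam := by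
  obtain ⟨k, hk⟩ := hμ
  refine ⟨g⁻¹ * k, fun x => ?_⟩
  rw [mul_inv_rev, inv_inv, ← adCLM_apply, adCLM_mul_apply]
  exact hk _

theorem mem_coadjointOrbit_self (lam : E →L[ℝ] ℝ) : lam ∈ coadjointOrbit E G lam :=
  ⟨1, fun x => by rw [inv_one, ← adCLM_apply, adCLM_one_apply]⟩

end Orbit

end LCLie

theorem mainTheorem6
    {E : Type*} [AddCommGroup E] [Module ℝ E] [TopologicalSpace E] [IsTopologicalAddGroup E]
    [ContinuousSMul ℝ E] [LocallyConvexSpace ℝ E] [T2Space E]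
    {G : Type*} [Group G] [TopologicalSpace G] [ChartedSpace E G]
    [LCLie.LocallyConvexLieGroup E G] [ConnectedSpace G]
    (h : LCLie.IsNilpotentLie E G ∨ LCLie.IsTwoStepSolvable E G) :
    (∀ lam : LCLie.LieAlg E G →L[ℝ] ℝ,
        LCLie.SemiEquicontinuous E (LCLie.coadjointOrbit E G lam) →
        LCLie.coadjointOrbit E G lam = {lam}) ∧
      LCLie.seqDual E G ⊆ LCLie.annihilator E G (LCLie.bracketSpan E G ⊤ ⊤) := by
  have key : ∀ lam : LCLie.LieAlg E G →L[ℝ] ℝ,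
      LCLie.SemiEquicontinuous E (LCLie.coadjointOrbit E G lam) →
      LCLie.KillsCentral G (LCLie.coadjointOrbit E G lam) 1 := fun lam hs =>
    h.elim
      (LCLie.killsCentral_one_of_isNilpotentLie
        (fun _ hμ g => LCLie.comp_adCLM_mem_coadjointOrbit hμ g) hs)
      (LCLie.killsCentral_one_of_isTwoStepSolvable
        (fun _ hμ g => LCLie.comp_adCLM_mem_coadjointOrbit hμ g) hs)
  refine ⟨fun lam hs => ?_, ?_⟩
  · refine Set.eq_singleton_iff_unique_mem.2 ⟨LCLie.mem_coadjointOrbit_self lam, ?_⟩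
    rintro μ ⟨g, hg⟩
    ext x
    -- Ad(g⁻¹)x - x lies in the closure of [𝔤,𝔤], where λ vanishes by continuity.
    have h1 := (key lam hs).closed (LCLie.mem_coadjointOrbit_self lam)
      (LCLie.adCLM_sub_mem_closed g⁻¹ (LCLie.mem_closedCentralSeries_zero (G := G) x))
    rw [hg, ← LCLie.adCLM_apply]
    rwa [map_sub, sub_eq_zero] at h1
  · rintro μ ⟨lam, hs, hμ⟩ x hx
    exact key lam hs μ hμ x hx
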